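/- Let $\Phi$ be a complex $n\times N$ matrix with $n\le N$. It satisfies the \emph{RIP of order $k$ with parameter $\delta$} if $(1-\delta)\|x\|^2\le\|\Phi x\|^2\le(1+\delta)\|x\|^2$ for every $x\in\mathbb C^N$ with at most $k$ nonzero coordinates; its \emph{RIP parameter of order $m$} is $\varepsilon=\sup |\|\Phi x\|^2/\|x\|^2-1|$ over the nonzero $x\in\mathbb C^N$ with at most $m$ nonzero coordinates. On input a matrix $\Phi$ with unit column vectors, an integer $2\le m\le n$ and $\delta\in(0,1)$, the \emph{lazy algorithm} determines, by enumerating the $m$-element sets of columns and doing linear algebra on each of the corresponding submatrices, all orders $k$ with $m\le k\le N$ and $\varepsilon(k-1)/(m-1)\le\delta$, and certifies that $\Phi$ satisfies the RIP of these orders with parameter $\delta$. (The comparisons of $\varepsilon$ with the numbers $\delta(m-1)/(k-1)$ are made exactly, by testing positive semidefiniteness with Gaussian elimination. Running time counts elementary steps: exact arithmetic operations and comparisons of scalars, index operations, array stores and loop rounds.) Then the algorithm is correct: for every such input it outputs exactly the orders $k$ just described, and $\Phi$ does satisfy the RIP of each of these orders with parameter $\delta$. Moreover, with $m=\lceil(\log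 N)^3\rceil$ (natural logarithm) and $N\ge 3$, the following holds. 1. There is an absolute constant $C>0$ such that on every $n\times N$ matrix with $n\le N$, and for every $\delta\in(0,1)$, the lazy algorithm runs in time at most $2^{C(\log N)^4}$. 2. There are absolute constants $K,c>0$ such that, for all $n\le N$ and all $\delta\in(0,1)$ with $K\delta\log N\sqrt n\ge m$, if $A$ is a random $n\times N$ matrix whose entries are independent symmetric Bernoulli ($\pm1$) random variables and $\Phi=\frac1{\sqrt n}A$, then with probability at least $1-2^{-c(\log N)^4}$ the following holds for all $k\le K\delta\log N\sqrt n$: the matrix $\Phi$ satisfies the RIP of order $k$ with parameter $\delta$, and if $k\ge m$ the lazy algorithm, run on $(\Phi,m,\delta)$, certifies this order. (The orders $k<m$ are covered because the RIP of order $m$ implies the RIP of every smaller order.) -/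

import Mathlib

open MeasureTheory ProbabilityTheory
open scoped ENNReal Matrix

noncomputable section

/-- A vector with at most `k` nonzero coordinates. -/
def IsSparse {N : ℕ} (k : ℕ) (x : Fin N → ℂ) : Prop :=
  (Function.support x).ncard ≤ k

/-- The squared Euclidean (Hermitian) norm. -/
def sqNorm {N : ℕ} (x : Fin N → ℂ) : ℝ :=
  ‖(WithLp.toLp 2 x : EuclideanSpace ℂ (Fin N))‖ ^ 2

/-- The restricted isometry property of order `k` with parameter `δ`. -/
def SatisfiesRIP {n N : ℕ} (Φ : Matrix (Fin n) (Fin N) ℂ) (k : ℕ) (δ : ℝ) : Prop :=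
  ∀ x : Fin N → ℂ, IsSparse k x →
    (1 - δ) * sqNorm x ≤ sqNorm (Φ *ᵥ x) ∧ sqNorm (Φ *ᵥ x) ≤ (1 + δ) * sqNorm x

/-- The RIP parameter of order `m`: the supremum of `| ‖Φ x‖² / ‖x‖² - 1 |` over the nonzero
`m`-sparse vectors `x`. -/
def ripParam {n N : ℕ} (Φ : Matrix (Fin n) (Fin N) ℂ) (m : ℕ) : ℝ :=
  sSup {t : ℝ | ∃ x : Fin N → ℂ, x ≠ 0 ∧ IsSparse m x ∧ t = |sqNorm (Φ *ᵥ x) / sqNorm x - 1|}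

/-- All column vectors have norm 1. -/
def HasUnitColumns {n N : ℕ} (Φ : Matrix (Fin n) (Fin N) ℂ) : Prop :=
  ∀ j, sqNorm (fun i => Φ i j) = 1

/-- A computation together with the number of elementary steps that it performs.
The elementary steps are those of a random access machine with exact arithmetic: one arithmetic
operation or comparison of scalars, one comparison or copy of an index, one store into an array,
one round of a loop, one call or return. Operands are fetched from arrays within the step
that uses them, and control only branches on the outcome of a counted test. -/
structure Timed (α : Type) where
  val : α
  steps : ℕ

namespace Timed

/-- One elementary step with result `a`. -/
def step {α : Type} (a : α) : Timed α := ⟨a, 1⟩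

/-- Sequential composition: the step counts add up. -/
instance : Monad Timed where
  pure a := ⟨a, 0⟩
  bind x f := ⟨(f x.val).val, x.steps + (f x.val).steps⟩

/-- Scalar addition. -/
def plus (a b : ℂ) : Timed ℂ := step (a + b)

/-- Scalar subtraction. -/
def minus (a b : ℂ) : Timed ℂ := step (a - b)

/-- Scalar multiplication. -/
def times (a b : ℂ) : Timed ℂ := step (a * b)

/-- Scalar division. -/
def quotient (a b : ℂ) : Timed ℂ := step (a / b)

/-- Complex conjugation. -/
def conjugate (a : ℂ) : Timed ℂ := step (star a)

open Classical in
/-- The test `a = 0`. -/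
def isZero (a : ℂ) : Timed Bool := step (decide (a = 0))

open Classical in
/-- The test `Re a > 0`. -/
def isPos (a : ℂ) : Timed Bool := step (decide (0 < a.re))

/-- The scalar `1` if the indices agree and `0` otherwise. -/
def kronecker {m : ℕ} (i j : Fin m) : Timed ℂ := step (if i = j then 1 else 0)

/-- A loop that computes and stores the entries of an `m × m` array one by one:
two further steps per entry (loop round and store), and one to leave the loop. -/
def fill (m : ℕ) (f : Fin m → Fin m → Timed ℂ) : Timed (Fin m → Fin m → ℂ) :=
  ⟨fun i j => (f i j).val, (∑ i, ∑ j, ((f i j).steps + 2)) + 1⟩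

/-- A loop that sums up `m` scalars, computed one by one:
two further steps per scalar (loop round and addition), and one to leave the loop. -/
def total (m : ℕ) (f : Fin m → Timed ℂ) : Timed ℂ :=
  ⟨∑ i, (f i).val, (∑ i, ((f i).steps + 2)) + 1⟩

/-- A loop that performs `m` tests and checks that all of them succeed:
two further steps per test (loop round and conjunction), and one to leave the loop. -/
def every (m : ℕ) (f : Fin m → Timed Bool) : Timed Bool :=
  ⟨decide (∀ i, (f i).val = true), (∑ i, ((f i).steps + 2)) + 1⟩

end Timed

open Timed

/-- Gaussian elimination, deciding whether the Hermitian matrix `M` is positive semidefinite: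
a positive pivot is eliminated, a zero pivot must come with a zero column, and a
negative pivot refutes positivity. -/
def psdTest : (m : ℕ) → (Fin m → Fin m → ℂ) → Timed Bool
  | 0, _ => step true
  | m + 1, M => do
    let positive ← isPos (M 0 0)
    if positive then
      let S ← fill m fun i j => do
        let p ← times (M i.succ 0) (M 0 j.succ)
        let q ← quotient p (M 0 0)
        minus (M i.succ j.succ) q
      psdTest m S
    else
      let zero ← isZero (M 0 0)
      if zero then
        let column ← every m fun i => isZero (M i.succ 0)
        if column then
          let S ← fill m fun i j => step (M i.succ j.succ)
          psdTest m S
        else step false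
      else step false

/-- For the submatrix `Φ_T` formed by the columns listed in `T`, decides whether
`| ‖Φ_T x‖² - ‖x‖² | ≤ r ‖x‖²` for all `x`, that is, whether the spectral radius of the
self-adjoint matrix `E = Φ_T^* Φ_T - I` is at most `r`: both `r I - E` and `r I + E` have to be
positive semidefinite. -/
def subsetTest {n N : ℕ} (Φ : Matrix (Fin n) (Fin N) ℂ) (r : ℂ) (T : List (Fin N)) :
    Timed Bool := do
  let E ← fill T.length fun a b => do
    let g ← total n fun i => do
      let u ← conjugate (Φ i (T.get a))
      times u (Φ i (T.get b))
    let d ← kronecker a b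
    minus g d
  let P ← fill T.length fun a b => do
    let d ← kronecker a b
    let rd ← times r d
    minus rd (E a b)
  let Q ← fill T.length fun a b => do
    let d ← kronecker a b
    let rd ← times r d
    plus rd (E a b)
  let upper ← psdTest T.length P
  let lower ← psdTest T.length Q
  step (upper && lower)

/-- Exhaustive enumeration: runs `test` on the sets made up of the elements of `T` and of `m`
entries of the list `pool`, until some test fails, and reports whether all of them succeed.
Each call first inspects `m` and `pool` in one step; pushing an entry of `pool` on the stack `T`
is one more step. (`pool` is the part of the array of all indices behind some position.) -/
def allSubsets {N : ℕ} (test : List (Fin N) → Timed Bool) :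
    (pool : List (Fin N)) → (m : ℕ) → (T : List (Fin N)) → Timed Bool
  | _, 0, T => do
    let _ ← step ()
    test T
  | [], _ + 1, _ => step true
  | i :: rest, m + 1, T => do
    let _ ← step ()
    let T' ← step (i :: T)
    let withEntry ← allSubsets test rest m T'
    if withEntry then allSubsets test rest (m + 1) T else step false

/-- The sublist of the entries that pass the test; two further steps per entry (loop round and
store), and one to leave the loop. -/
def select (test : ℕ → Timed Bool) : List ℕ → Timed (List ℕ)
  | [] => step []
  | k :: rest => do
    let _ ← step ()
    let ok ← test k
    let tail ← select test rest
    if ok then step (k :: tail) else step tail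

/-- The lazy algorithm. It enumerates the `m`-element sets of columns, and returns the list of all
`k` with `m ≤ k ≤ N` such that the RIP parameter `ε` of order `m` satisfies
`ε (k - 1) / (m - 1) ≤ δ`. The parameter `ε` is an algebraic function of the entries that need
not be an exact result of arithmetic operations; it is accessed through the comparisons of `ε`
with the numbers `δ (m - 1) / (k - 1)`, which arithmetic decides exactly. The loop that writes
down the array of all column indices takes `2 N + 1` steps. -/
def lazyAlgorithm {n N : ℕ} (Φ : Matrix (Fin n) (Fin N) ℂ) (m : ℕ) (δ : ℝ) :
    Timed (List ℕ) :=
  do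
    let pool ← (⟨List.finRange N, 2 * N + 1⟩ : Timed (List (Fin N)))
    select
      (fun k => do
        let a ← minus (m : ℂ) 1
        let b ← minus (k : ℂ) 1
        let c ← times (δ : ℂ) a
        let r ← quotient c b
        allSubsets (subsetTest Φ r) pool m [])
      (List.range' m (N + 1 - m))

/-- The entries of the random matrix `A` are independent symmetric Bernoulli variables. -/
structure IsBernoulliMatrix {Ω : Type*} [MeasurableSpace Ω] (μ : Measure Ω) {n N : ℕ}
    (A : Ω → Matrix (Fin n) (Fin N) ℝ) : Prop where
  measurable : ∀ i j, Measurable fun ω => A ω i j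
  indep : iIndepFun (fun (p : Fin n × Fin N) (ω : Ω) => A ω p.1 p.2) μ
  prob_one : ∀ i j, μ {ω | A ω i j = 1} = 1 / 2
  prob_neg_one : ∀ i j, μ {ω | A ω i j = -1} = 1 / 2

/-- The normalized matrix `A / √n`, seen as a complex matrix. -/
def normalized {n N : ℕ} (A : Matrix (Fin n) (Fin N) ℝ) : Matrix (Fin n) (Fin N) ℂ :=
  A.map fun a => ((a / √(n : ℝ) : ℝ) : ℂ)

/-- The integer order `m = ⌈(log N)³⌉`. -/
def lazyOrder (N : ℕ) : ℕ := ⌈Real.log N ^ 3⌉₊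

end

/-! Write D(x) = ‖Φx‖² − ‖x‖², the quadratic form of E = Φ*Φ − I. Unit columns mean that E has zero
diagonal, so D(x) is a sum over ordered pairs of distinct coordinates. If x lives on k + 1
coordinates, then among its k + 1 one-coordinate deletions each such pair survives k − 1 times,
while each |x_i|² survives k times. Averaging a bound |D| ≤ θ(k − 1)‖·‖² for order k over the
deletions gives |D(x)| ≤ θk‖x‖². Hence the RIP parameter of order k divided by k − 1 does not
increase with k (`abs_deviation_le_of_le`), which makes every certificate sound.

The algorithm compares ε with r = δ(m − 1)/(k − 1): ε ≤ r says that rI − E and rI + E are positive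
semidefinite on every m-set of columns, and elimination decides this by Schur complements
(`psdTest_val_iff`). Fewer than N orders, about N^m sets and cubic work per set give time exp(O(m
log N)).

For the random matrix, a row applied to a real vector y in the unit ball is subgaussian with
parameter 1. A Gaussian mixture turns this into exponential moments of its square, and a Chernoff
bound over the independent rows gives tail 2 exp(−nτ²/1024) (`measureReal_abs_sum_ge_le`). A
polynomially fine grid costs only N^(7m) in the union bound. With R = log N · √n / 512 and the
target |D| ≤ ((m − 1)/R)‖x‖² for m-sparse x, the tail exponent is 64(m − 1)²/(log N)². It beats 7m
log N because m ≥ (log N)³, and the failure probability is about exp(−m log N). On the good event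
all orders up to δR are certified. -/

noncomputable section

open Timed

namespace Timed

@[simp] theorem val_bind {α β : Type} (x : Timed α) (f : α → Timed β) :
    (x >>= f).val = (f x.val).val := rfl

@[simp] theorem steps_bind {α β : Type} (x : Timed α) (f : α → Timed β) :
    (x >>= f).steps = x.steps + (f x.val).steps := rfl

@[simp] theorem val_step {α : Type} (a : α) : (step a).val = a := rfl

@[simp] theorem steps_step {α : Type} (a : α) : (step a).steps = 1 := rfl

end Timed

/-! ### Gaussian elimination and positive semidefiniteness -/

/-- The real part of the sesquilinear form of a square array. -/
def hermForm {m : ℕ} (M : Fin m → Fin m → ℂ) (v : Fin m → ℂ) : ℝ :=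
  (∑ i, ∑ j, star (v i) * M i j * v j).re

/-- One step of Gaussian elimination. -/
def schurStep {m : ℕ} (M : Fin (m + 1) → Fin (m + 1) → ℂ) : Fin m → Fin m → ℂ :=
  fun i j => M i.succ j.succ - M i.succ 0 * M 0 j.succ / M 0 0

theorem hermForm_succ {m : ℕ} (M : Fin (m + 1) → Fin (m + 1) → ℂ) (v : Fin (m + 1) → ℂ) :
    hermForm M v = (star (v 0) * M 0 0 * v 0 + star (v 0) * (∑ j, M 0 (Fin.succ j) * v j.succ)
      + (∑ i, star (v (Fin.succ i)) * M i.succ 0) * v 0).re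
      + hermForm (fun i j => M i.succ j.succ) (fun i => v i.succ) := by
  simp only [hermForm, ← Complex.add_re]
  congr 1
  simp only [Fin.sum_univ_succ, Finset.sum_add_distrib, Finset.mul_sum, Finset.sum_mul, mul_assoc]
  ring

theorem hermForm_schurStep {m : ℕ} (M : Fin (m + 1) → Fin (m + 1) → ℂ) (w : Fin m → ℂ) :
    hermForm (schurStep M) w = hermForm (fun i j => M i.succ j.succ) w -
      ((∑ i, star (w i) * M (Fin.succ i) 0) * (∑ j, M 0 (Fin.succ j) * w j) / M 0 0).re := by
  simp only [hermForm, schurStep, ← Complex.sub_re]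
  congr 1
  simp only [Finset.sum_mul_sum, Finset.sum_div, ← Finset.sum_sub_distrib]
  refine Finset.sum_congr rfl fun i _ => Finset.sum_congr rfl fun j _ => ?_
  ring

/-- Completing the square in `v 0`: by Hermitian symmetry the first column is the conjugate of the
first row, and what the square leaves over is the Schur complement. -/
theorem hermForm_succ_of_pos {m : ℕ} {M : Fin (m + 1) → Fin (m + 1) → ℂ}
    (hM : ∀ i j, M i j = star (M j i)) (h0 : 0 < (M 0 0).re) (v : Fin (m + 1) → ℂ) :
    hermForm M v = (M 0 0).re * ‖v 0 + (∑ j, M 0 (Fin.succ j) * v j.succ) / M 0 0‖ ^ 2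
      + hermForm (schurStep M) (fun i => v i.succ) := by
  rw [hermForm_succ, hermForm_schurStep]
  have hreal : M 0 0 = ((M 0 0).re : ℂ) := by
    have h := hM 0 0
    exact (Complex.conj_eq_iff_real.mp h.symm).elim fun r hr => by rw [hr]; simp
  set b := ∑ j, M 0 (Fin.succ j) * v j.succ with hb
  have hstar : (∑ i, star (v (Fin.succ i)) * M i.succ 0) = star b := by
    rw [hb, star_sum]
    refine Finset.sum_congr rfl fun i _ => ?_
    rw [star_mul, ← hM]
  rw [hstar]
  set p := (M 0 0).re
  rw [hreal]
  have hp : (p : ℂ) ≠ 0 := by exact_mod_cast h0.ne'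
  have key : (star (v 0) * p * v 0 + star (v 0) * b + star b * v 0) =
      ((p * ‖v 0 + b / p‖ ^ 2 : ℝ) : ℂ) - star b * b / p := by
    push_cast
    rw [← Complex.conj_mul']
    simp only [map_add, map_div₀, Complex.conj_ofReal, Complex.star_def]
    field_simp
    ring
  rw [key, Complex.sub_re, Complex.ofReal_re]
  ring

theorem hermForm_nonneg_iff_of_pos {m : ℕ} {M : Fin (m + 1) → Fin (m + 1) → ℂ}
    (hM : ∀ i j, M i j = star (M j i)) (h0 : 0 < (M 0 0).re) :
    (∀ v, 0 ≤ hermForm M v) ↔ ∀ w, 0 ≤ hermForm (schurStep M) w := by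
  constructor
  · intro h w
    -- This first coordinate makes the completed square vanish.
    have := h (Fin.cons (-((∑ j, M 0 (Fin.succ j) * w j) / M 0 0)) w)
    rw [hermForm_succ_of_pos hM h0] at this
    simpa using this
  · intro h v
    rw [hermForm_succ_of_pos hM h0]
    have := h fun i => v i.succ
    positivity

/-- With a zero pivot the form has no quadratic term in `v 0`; a nonzero border entry leaves a
linear term, which is unbounded below. -/
theorem hermForm_nonneg_iff_of_zero {m : ℕ} {M : Fin (m + 1) → Fin (m + 1) → ℂ}
    (hM : ∀ i j, M i j = star (M j i)) (h0 : M 0 0 = 0) :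
    (∀ v, 0 ≤ hermForm M v) ↔
      (∀ i : Fin m, M i.succ 0 = 0) ∧ ∀ w, 0 ≤ hermForm (fun i j => M i.succ j.succ) w := by
  constructor
  · intro h
    refine ⟨fun i => ?_, fun w => ?_⟩
    · by_contra hne
      set a := M i.succ 0 with ha
      set d := (M i.succ i.succ).re with hd
      -- On −s·ā·e₀ + e_i the form is affine in s with negative slope; s = (|d| + 1)/‖a‖² below
      -- makes it negative.
      have hval : ∀ s : ℝ, hermForm M (Fin.cons (-(s : ℂ) * star a) (Pi.single i 1)) =
          d - 2 * s * ‖a‖ ^ 2 := by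
        intro s
        rw [hermForm_succ, h0]
        have h1 : hermForm (fun i j => M i.succ j.succ) (Pi.single i 1) = d := by
          simp [hermForm, Pi.single_apply, hd, apply_ite, Finset.sum_ite_eq']
        have h2 : M 0 i.succ = star a := by rw [hM]
        simp only [Fin.cons_zero, Fin.cons_succ, h1]
        have e1 : (∑ j, M 0 (Fin.succ j) * (Pi.single i 1 : Fin m → ℂ) j) = star a := by
          simp [Pi.single_apply, h2]
        have e2 : (∑ j, star ((Pi.single i 1 : Fin m → ℂ) j) * M (Fin.succ j) 0) = a := by
          simp [Pi.single_apply, ha, apply_ite]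
        rw [e1, e2]
        have : star (-(s : ℂ) * star a) * 0 * (-(s : ℂ) * star a) + star (-(s : ℂ) * star a) * star a
            + a * (-(s : ℂ) * star a) = ((-2 * s * ‖a‖ ^ 2 : ℝ) : ℂ) := by
          push_cast
          rw [← Complex.conj_mul']
          simp
          ring
        rw [this, Complex.ofReal_re]
        ring
      have hpos : 0 < ‖a‖ ^ 2 := by positivity
      have := h (Fin.cons (-(((|d| + 1) / ‖a‖ ^ 2 : ℝ) : ℂ) * star a) (Pi.single i 1))
      rw [hval] at this
      have e : 2 * ((|d| + 1) / ‖a‖ ^ 2) * ‖a‖ ^ 2 = 2 * (|d| + 1) := by field_simp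
      rw [e] at this
      linarith [le_abs_self d, abs_nonneg d]
    · have := h (Fin.cons 0 w)
      rw [hermForm_succ] at this
      simpa using this
  · rintro ⟨hc, h⟩ v
    rw [hermForm_succ]
    have hr : ∀ j : Fin m, M 0 j.succ = 0 := fun j => by rw [hM, hc, star_zero]
    simpa [h0, hc, hr] using h fun i => v i.succ

theorem psdTest_val_iff : ∀ {m : ℕ} (M : Fin m → Fin m → ℂ), (∀ i j, M i j = star (M j i)) →
    ((psdTest m M).val = true ↔ ∀ v, 0 ≤ hermForm M v)
  | 0, M, _ => by simp [psdTest, hermForm]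
  | m + 1, M, hM => by
    have hS : ∀ i j, schurStep M i j = star (schurStep M j i) := by
      intro i j
      simp only [schurStep, star_sub, star_div₀, star_mul]
      rw [← hM, ← hM, ← hM, ← hM, mul_comm]
    have hS' : ∀ i j : Fin m, M i.succ j.succ = star (M j.succ i.succ) := fun i j => hM _ _
    rw [psdTest]
    simp only [isPos, val_bind, val_step, decide_eq_true_eq]
    by_cases h0 : 0 < (M 0 0).re
    · rw [if_pos h0, hermForm_nonneg_iff_of_pos hM h0]
      exact psdTest_val_iff (schurStep M) hS
    · rw [if_neg h0]
      simp only [isZero, val_bind, val_step, decide_eq_true_eq]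
      by_cases h1 : M 0 0 = 0
      · rw [if_pos h1, hermForm_nonneg_iff_of_zero hM h1]
        by_cases h2 : ∀ i : Fin m, M i.succ 0 = 0
        · simp only [val_bind, every, val_step, decide_eq_true_eq, if_pos h2]
          rw [and_iff_right h2]
          exact psdTest_val_iff _ hS'
        · simp only [val_bind, every, val_step, decide_eq_true_eq, if_neg h2]
          simp [h2]
      · rw [if_neg h1]
        simp only [val_step, Bool.false_eq_true, false_iff, not_forall, not_le]
        -- A pivot of a Hermitian array is real; being nonzero and not positive, it is negative, and
        -- e₀ is a witness.
        refine ⟨Fin.cons 1 0, ?_⟩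
        rw [hermForm_succ]
        have him : (M 0 0).im = 0 := by
          have := congrArg Complex.im (hM 0 0)
          simp at this
          linarith
        have : (M 0 0).re ≠ 0 := fun h => h1 (Complex.ext h him)
        simpa [hermForm] using lt_of_le_of_ne (not_lt.mp h0) this

/-! ### Deviation from isometry and the RIP parameter -/

theorem sqNorm_eq_sum {N : ℕ} (x : Fin N → ℂ) : sqNorm x = ∑ i, ‖x i‖ ^ 2 := by
  rw [sqNorm, EuclideanSpace.norm_sq_eq]

theorem sqNorm_nonneg {N : ℕ} (x : Fin N → ℂ) : 0 ≤ sqNorm x := by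
  unfold sqNorm; positivity

theorem sqNorm_pos {N : ℕ} {x : Fin N → ℂ} (hx : x ≠ 0) : 0 < sqNorm x := by
  have : (WithLp.toLp 2 x : EuclideanSpace ℂ (Fin N)) ≠ 0 := by simpa using hx
  unfold sqNorm; positivity

theorem ofReal_sqNorm {N : ℕ} (x : Fin N → ℂ) : (sqNorm x : ℂ) = ∑ i, star (x i) * x i := by
  rw [sqNorm_eq_sum]
  push_cast
  exact Finset.sum_congr rfl fun i _ => (Complex.conj_mul' _).symm

/-- The deviation of a matrix from being isometric at the vector `x`. -/
def deviation {n N : ℕ} (Φ : Matrix (Fin n) (Fin N) ℂ) (x : Fin N → ℂ) : ℝ :=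
  sqNorm (Φ *ᵥ x) - sqNorm x

theorem satisfiesRIP_iff {n N : ℕ} (Φ : Matrix (Fin n) (Fin N) ℂ) (k : ℕ) (δ : ℝ) :
    SatisfiesRIP Φ k δ ↔ ∀ x, IsSparse k x → |deviation Φ x| ≤ δ * sqNorm x := by
  refine forall₂_congr fun x _ => ?_
  rw [deviation, abs_le]
  constructor <;> rintro ⟨h1, h2⟩ <;> constructor <;> linarith

/-- Serves to show that the set in `ripParam` is bounded above; otherwise its `sSup` would be the
default value 0. -/
theorem exists_sqNorm_mulVec_le {n N : ℕ} (Φ : Matrix (Fin n) (Fin N) ℂ) :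
    ∃ C, ∀ x, sqNorm (Φ *ᵥ x) ≤ C * sqNorm x := by
  let L := (Matrix.toEuclideanLin Φ).toContinuousLinearMap
  refine ⟨‖L‖ ^ 2, fun x => ?_⟩
  have h := L.le_opNorm (WithLp.toLp 2 x)
  have : L (WithLp.toLp 2 x) = WithLp.toLp 2 (Φ *ᵥ x) := rfl
  rw [this] at h
  unfold sqNorm
  rw [← mul_pow]
  gcongr

theorem ripParam_le_iff {n N : ℕ} (Φ : Matrix (Fin n) (Fin N) ℂ) (m : ℕ) {r : ℝ} (hr : 0 ≤ r) :
    ripParam Φ m ≤ r ↔ ∀ x, IsSparse m x → |deviation Φ x| ≤ r * sqNorm x := by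
  have key : ∀ x : Fin N → ℂ, x ≠ 0 →
      |sqNorm (Φ *ᵥ x) / sqNorm x - 1| = |deviation Φ x| / sqNorm x := by
    intro x hx
    have := sqNorm_pos hx
    rw [deviation, ← abs_of_pos this, ← abs_div, abs_of_pos this, sub_div, div_self this.ne']
  constructor
  · intro h x hx
    rcases eq_or_ne x 0 with rfl | h0
    · simp [deviation, sqNorm]
    · rw [← div_le_iff₀ (sqNorm_pos h0), ← key x h0]
      refine le_trans (b := ripParam Φ m) ?_ h
      refine le_csSup ?_ ⟨x, h0, hx, rfl⟩
      obtain ⟨C, hC⟩ := exists_sqNorm_mulVec_le Φ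
      refine ⟨|C| + 1, ?_⟩
      rintro t ⟨y, hy, -, rfl⟩
      have h1 : sqNorm (Φ *ᵥ y) / sqNorm y ≤ C := (div_le_iff₀ (sqNorm_pos hy)).2 (hC y)
      have h2 : 0 ≤ sqNorm (Φ *ᵥ y) / sqNorm y := div_nonneg (sqNorm_nonneg _) (sqNorm_nonneg _)
      rw [abs_le]
      constructor <;> linarith [le_abs_self C, abs_nonneg C]
  · intro h
    -- The set is empty when no nonzero vector is `m`-sparse; its supremum is then 0, whence `0 ≤
    -- r`.
    refine Real.sSup_le ?_ hr
    rintro t ⟨y, hy, hs, rfl⟩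
    rw [key y hy, div_le_iff₀ (sqNorm_pos hy)]
    exact h y hs

theorem ripParam_nonneg {n N : ℕ} (Φ : Matrix (Fin n) (Fin N) ℂ) (m : ℕ) : 0 ≤ ripParam Φ m := by
  refine Real.sSup_nonneg ?_
  rintro t ⟨y, -, -, rfl⟩
  exact abs_nonneg _

/-! ### Deleting coordinates: from order m to larger orders -/

theorem sqNorm_sub_single {N : ℕ} (x : Fin N → ℂ) (s : Fin N) :
    sqNorm (x - Pi.single s (x s)) = sqNorm x - ‖x s‖ ^ 2 := by
  simp only [sqNorm_eq_sum]
  rw [← Finset.add_sum_erase _ _ (Finset.mem_univ s),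
    ← Finset.add_sum_erase (a := s) _ (fun i => ‖x i‖ ^ 2) (Finset.mem_univ s)]
  simp only [Pi.sub_apply, Pi.single_eq_same, sub_self, norm_zero]
  rw [Finset.sum_congr rfl (g := fun i => ‖x i‖ ^ 2)]
  · ring
  · intro i hi
    rw [Pi.single_eq_of_ne (Finset.ne_of_mem_erase hi), sub_zero]

/-- The term |x_s|² comes twice: once as the squared norm of the removed multiple of a unit column,
once from shrinking ‖x‖². -/
theorem deviation_sub_single {n N : ℕ} {Φ : Matrix (Fin n) (Fin N) ℂ} (hΦ : HasUnitColumns Φ)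
    (x : Fin N → ℂ) (s : Fin N) :
    deviation Φ (x - Pi.single s (x s)) = sqNorm (Φ *ᵥ x) - sqNorm x + 2 * ‖x s‖ ^ 2
      - 2 * (∑ l, star ((Φ *ᵥ x) l) * (Φ l s * x s)).re := by
  have h2 : sqNorm (Φ *ᵥ (x - Pi.single s (x s))) = sqNorm (Φ *ᵥ x) + ‖x s‖ ^ 2
      - 2 * (∑ l, star ((Φ *ᵥ x) l) * (Φ l s * x s)).re := by
    have hc : ∀ l, (Φ *ᵥ (x - Pi.single s (x s))) l = (Φ *ᵥ x) l - Φ l s * x s := by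
      intro l
      rw [Matrix.mulVec_sub, Pi.sub_apply, Matrix.mulVec_single]
      simp
    have hu : ∑ l, ‖Φ l s * x s‖ ^ 2 = ‖x s‖ ^ 2 := by
      have := hΦ s
      rw [sqNorm_eq_sum] at this
      simp only [norm_mul, mul_pow, ← Finset.sum_mul, this, one_mul]
    rw [sqNorm_eq_sum, sqNorm_eq_sum, ← hu, Complex.re_sum, Finset.mul_sum,
      ← Finset.sum_add_distrib, ← Finset.sum_sub_distrib]
    refine Finset.sum_congr rfl fun l _ => ?_
    rw [hc]
    generalize (Φ *ᵥ x) l = a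
    generalize Φ l s * x s = b
    rw [← Complex.normSq_eq_norm_sq, ← Complex.normSq_eq_norm_sq, ← Complex.normSq_eq_norm_sq]
    simp only [Complex.normSq_apply, Complex.sub_re, Complex.sub_im, Complex.mul_re,
      Complex.star_def, Complex.conj_re, Complex.conj_im]
    ring
  rw [deviation, sqNorm_sub_single, h2]
  ring

/-- The factor is |S| − 2 because Φ*Φ − I has zero diagonal: a pair of distinct indices is destroyed
by exactly two of the deletions. In the computation, the cross terms add up to 2‖Φx‖² and the terms
|x_s|² to 2‖x‖². -/
theorem sum_deviation_sub_single {n N : ℕ} {Φ : Matrix (Fin n) (Fin N) ℂ}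
    (hΦ : HasUnitColumns Φ) (x : Fin N → ℂ) (S : Finset (Fin N)) (hS : ∀ i ∉ S, x i = 0) :
    ∑ s ∈ S, deviation Φ (x - Pi.single s (x s)) = ((S.card : ℝ) - 2) * deviation Φ x := by
  simp only [deviation_sub_single hΦ, Finset.sum_sub_distrib, Finset.sum_add_distrib,
    Finset.sum_const, nsmul_eq_mul, ← Finset.mul_sum, ← Complex.re_sum]
  have h1 : ∑ s ∈ S, ‖x s‖ ^ 2 = sqNorm x := by
    rw [sqNorm_eq_sum]
    exact Finset.sum_subset (Finset.subset_univ _) fun i _ hi => by simp [hS i hi]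
  have h2 : ∑ s ∈ S, ∑ l, star ((Φ *ᵥ x) l) * (Φ l s * x s) = (sqNorm (Φ *ᵥ x) : ℂ) := by
    rw [Finset.sum_comm, ofReal_sqNorm]
    refine Finset.sum_congr rfl fun l _ => ?_
    rw [← Finset.mul_sum]
    congr 1
    rw [Matrix.mulVec, dotProduct]
    exact Finset.sum_subset (Finset.subset_univ _) fun i _ hi => by simp [hS i hi]
  rw [h1, h2, Complex.ofReal_re, deviation]
  ring

theorem sum_sqNorm_sub_single {N : ℕ} (x : Fin N → ℂ) (S : Finset (Fin N))
    (hS : ∀ i ∉ S, x i = 0) :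
    ∑ s ∈ S, sqNorm (x - Pi.single s (x s)) = ((S.card : ℝ) - 1) * sqNorm x := by
  have h1 : ∑ s ∈ S, ‖x s‖ ^ 2 = sqNorm x := by
    rw [sqNorm_eq_sum]
    exact Finset.sum_subset (Finset.subset_univ _) fun i _ hi => by simp [hS i hi]
  simp only [sqNorm_sub_single, Finset.sum_sub_distrib, h1, Finset.sum_const, nsmul_eq_mul]
  ring

theorem IsSparse.mono {N k l : ℕ} {x : Fin N → ℂ} (h : IsSparse k x) (hkl : k ≤ l) :
    IsSparse l x := le_trans h hkl

theorem isSparse_of_forall_notMem {N k : ℕ} {x : Fin N → ℂ} {S : Finset (Fin N)}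
    (hS : ∀ i ∉ S, x i = 0) (hk : S.card ≤ k) : IsSparse k x := by
  refine le_trans ?_ hk
  rw [← Set.ncard_coe_finset]
  exact Set.ncard_le_ncard (fun i hi => by_contra fun h => hi (hS i h)) (Finset.finite_toSet S)

theorem IsSparse.exists_finset {N k : ℕ} {x : Fin N → ℂ} (h : IsSparse k x) (hk : k ≤ N) :
    ∃ S : Finset (Fin N), S.card = k ∧ ∀ i ∉ S, x i = 0 := by
  classical
  have h' : (Finset.univ.filter fun i => x i ≠ 0).card ≤ k := by
    rw [← Set.ncard_coe_finset, Finset.coe_filter]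
    simpa [IsSparse, Function.support] using h
  obtain ⟨S, hS, hc⟩ := Finset.exists_superset_card_eq h' (by simpa using hk)
  exact ⟨S, hc, fun i hi => by_contra fun hne => hi (hS (by simpa using hne))⟩

/-- A bound for the restricted isometry constant of one order gives bounds for larger orders. -/
theorem abs_deviation_le_of_le {n N m : ℕ} {Φ : Matrix (Fin n) (Fin N) ℂ}
    (hΦ : HasUnitColumns Φ) (hm : 2 ≤ m) {θ : ℝ} (hθ : 0 ≤ θ)
    (h : ∀ x, IsSparse m x → |deviation Φ x| ≤ θ * ((m : ℝ) - 1) * sqNorm x) {k : ℕ}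
    (hk : m ≤ k) : ∀ x, IsSparse k x → |deviation Φ x| ≤ θ * ((k : ℝ) - 1) * sqNorm x := by
  induction k, hk using Nat.le_induction with
  | base => exact h
  | succ k hk ih =>
    intro x hx
    have hk2 : (2 : ℝ) ≤ k := by exact_mod_cast hm.trans hk
    by_cases hxk : IsSparse k x
    · refine (ih x hxk).trans ?_
      have := sqNorm_nonneg x
      gcongr
      simp
    · have hkN : k + 1 ≤ N := by
        by_contra hlt
        refine hxk (le_trans (Set.ncard_le_card _) ?_)
        rw [Nat.card_eq_fintype_card, Fintype.card_fin]
        omega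
      obtain ⟨S, hc, hS⟩ := hx.exists_finset hkN
      have e1 := sum_deviation_sub_single hΦ x S hS
      have e2 := sum_sqNorm_sub_single x S hS
      rw [hc] at e1 e2
      push_cast at e1 e2 ⊢
      -- Each deletion is `k`-sparse. The left side equals (k − 1)|D(x)| and the right side θ(k −
      -- 1)k‖x‖², so cancelling k − 1, positive since m ≥ 2, gives order k + 1.
      have h3 : |∑ s ∈ S, deviation Φ (x - Pi.single s (x s))| ≤
          θ * ((k : ℝ) - 1) * (((k : ℝ) + 1 - 1) * sqNorm x) := by
        rw [← e2, Finset.mul_sum]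
        refine (Finset.abs_sum_le_sum_abs _ _).trans (Finset.sum_le_sum fun s hs => ih _ ?_)
        refine isSparse_of_forall_notMem (S := S.erase s) (fun i hi => ?_) ?_
        · by_cases his : i = s
          · subst his; simp
          · rw [Pi.sub_apply, Pi.single_eq_of_ne his, sub_zero]
            exact hS i fun h => hi (Finset.mem_erase.2 ⟨his, h⟩)
        · rw [Finset.card_erase_of_mem hs, hc]; simp
      rw [e1, abs_mul, abs_of_nonneg (by linarith)] at h3
      have h4 : (0 : ℝ) < (k : ℝ) - 1 := by linarith
      refine le_of_mul_le_mul_left ?_ h4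
      calc ((k : ℝ) - 1) * |deviation Φ x| = ((k : ℝ) + 1 - 2) * |deviation Φ x| := by ring
        _ ≤ _ := h3
        _ = _ := by ring

/-! ### Correctness of the enumeration and of the algorithm -/

/-- A sublist of `i :: rest` either starts with `i` or avoids it, matching the two recursive calls.
Entries are pushed at the head of the stack, hence the reversal. -/
theorem allSubsets_val_iff {N : ℕ} (test : List (Fin N) → Timed Bool) :
    ∀ (pool : List (Fin N)) (m : ℕ) (T : List (Fin N)),
      ((allSubsets test pool m T).val = true ↔
        ∀ l : List (Fin N), l.Sublist pool → l.length = m → (test (l.reverse ++ T)).val = true)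
  | pool, 0, T => by
    have : (allSubsets test pool 0 T).val = (test T).val := by cases pool <;> rfl
    rw [this]
    constructor
    · intro h l _ hl
      rw [List.length_eq_zero_iff] at hl
      simpa [hl] using h
    · intro h
      simpa using h [] (List.nil_sublist _) rfl
  | [], m + 1, T => by
    simp only [allSubsets, val_step, true_iff]
    intro l hl hlen
    rw [List.sublist_nil] at hl
    simp [hl] at hlen
  | i :: rest, m + 1, T => by
    have ih1 := allSubsets_val_iff test rest m (i :: T)
    have ih2 := allSubsets_val_iff test rest (m + 1) T
    have hval : (allSubsets test (i :: rest) (m + 1) T).val = true ↔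
        (allSubsets test rest m (i :: T)).val = true ∧
          (allSubsets test rest (m + 1) T).val = true := by
      rw [allSubsets]
      simp only [val_bind, val_step]
      split_ifs with hif <;> simp [hif]
    rw [hval, ih1, ih2]
    constructor
    · rintro ⟨h1, h2⟩ l hl hlen
      rcases List.sublist_cons_iff.1 hl with h | ⟨r, rfl, hr⟩
      · exact h2 l h hlen
      · simpa using h1 r hr (by simpa using hlen)
    · intro h
      refine ⟨fun l hl hlen => ?_, fun l hl hlen => h l (hl.cons _) hlen⟩
      simpa using h (i :: l) (hl.cons_cons i) (by simpa using hlen)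

theorem mem_select_val {test : ℕ → Timed Bool} {k : ℕ} :
    ∀ {l : List ℕ}, (k ∈ (select test l).val ↔ k ∈ l ∧ (test k).val = true)
  | [] => by simp [select]
  | a :: l => by
    have ih := mem_select_val (test := test) (k := k) (l := l)
    rw [select]
    simp only [val_bind]
    split_ifs with h
    · simp only [val_step, List.mem_cons, ih]
      constructor
      · rintro (rfl | h') <;> tauto
      · tauto
    · simp only [val_step, List.mem_cons, ih]
      constructor
      · tauto
      · rintro ⟨rfl | h', h2⟩
        · exact absurd h2 h
        · exact ⟨h', h2⟩

/-- The submatrix of the columns listed in `T`. -/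
def columns {n N : ℕ} (Φ : Matrix (Fin n) (Fin N) ℂ) (T : List (Fin N)) :
    Matrix (Fin n) (Fin T.length) ℂ := Φ.submatrix id T.get

theorem sum_star_gram {n m : ℕ} (B : Matrix (Fin n) (Fin m) ℂ) (v : Fin m → ℂ) :
    ∑ a, ∑ b, star (v a) * (∑ i, star (B i a) * B i b) * v b = (sqNorm (B *ᵥ v) : ℂ) := by
  rw [ofReal_sqNorm]
  simp only [Matrix.mulVec, dotProduct, star_sum, Finset.mul_sum, Finset.sum_mul]
  rw [Finset.sum_comm' (t' := Finset.univ) (s' := fun _ => Finset.univ) (by simp)]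
  rw [Finset.sum_comm]
  conv_lhs => enter [2, x]; rw [Finset.sum_comm]
  rw [Finset.sum_comm]
  refine Finset.sum_congr rfl fun i _ => ?_
  rw [Finset.sum_comm]
  refine Finset.sum_congr rfl fun a _ => Finset.sum_congr rfl fun b _ => ?_
  rw [star_mul]
  ring

theorem sum_star_one {m : ℕ} (v : Fin m → ℂ) :
    ∑ a, ∑ b, star (v a) * (if a = b then 1 else 0) * v b = (sqNorm v : ℂ) := by
  rw [ofReal_sqNorm]
  simp

/-- The forms of rI − E and rI + E are r‖v‖² − D(v) and r‖v‖² + D(v); both are nonnegative exactly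
when |D(v)| ≤ r‖v‖². -/
theorem subsetTest_val_iff {n N : ℕ} (Φ : Matrix (Fin n) (Fin N) ℂ) (r : ℝ) (T : List (Fin N)) :
    (subsetTest Φ (r : ℂ) T).val = true ↔
      ∀ v, |deviation (columns Φ T) v| ≤ r * sqNorm v := by
  set G : Fin T.length → Fin T.length → ℂ := fun a b => ∑ i, star (columns Φ T i a) * columns Φ T i b
    with hG
  set D : Fin T.length → Fin T.length → ℂ := fun a b => if a = b then 1 else 0 with hD
  have hval : (subsetTest Φ (r : ℂ) T).val =
      ((psdTest T.length fun a b => r * D a b - (G a b - D a b)).val &&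
        (psdTest T.length fun a b => r * D a b + (G a b - D a b)).val) := rfl
  have hGs : ∀ a b, G a b = star (G b a) := by
    intro a b
    simp only [hG, star_sum, star_mul, star_star]
  have hDs : ∀ a b, D a b = star (D b a) := by
    intro a b
    simp only [hD, eq_comm (a := b)]
    split_ifs <;> simp
  have hrs : star (r : ℂ) = r := Complex.conj_ofReal r
  have hform1 : ∀ v, hermForm (fun a b => r * D a b - (G a b - D a b)) v =
      r * sqNorm v - deviation (columns Φ T) v := by
    intro v
    have : ∑ a, ∑ b, star (v a) * (r * D a b - (G a b - D a b)) * v b =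
        ((r * sqNorm v - deviation (columns Φ T) v : ℝ) : ℂ) := by
      rw [deviation]
      push_cast
      rw [← sum_star_gram, ← sum_star_one]
      simp only [Finset.mul_sum, ← Finset.sum_sub_distrib]
      refine Finset.sum_congr rfl fun a _ => Finset.sum_congr rfl fun b _ => ?_
      simp only [hG, hD, ← Finset.mul_sum]
      ring
    rw [hermForm, this, Complex.ofReal_re]
  have hform2 : ∀ v, hermForm (fun a b => r * D a b + (G a b - D a b)) v =
      r * sqNorm v + deviation (columns Φ T) v := by
    intro v
    have : ∑ a, ∑ b, star (v a) * (r * D a b + (G a b - D a b)) * v b =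
        ((r * sqNorm v + deviation (columns Φ T) v : ℝ) : ℂ) := by
      rw [deviation]
      push_cast
      rw [← sum_star_gram, ← sum_star_one]
      simp only [Finset.mul_sum, ← Finset.sum_sub_distrib, ← Finset.sum_add_distrib]
      refine Finset.sum_congr rfl fun a _ => Finset.sum_congr rfl fun b _ => ?_
      simp only [hG, hD, ← Finset.mul_sum]
      ring
    rw [hermForm, this, Complex.ofReal_re]
  rw [hval, Bool.and_eq_true, psdTest_val_iff, psdTest_val_iff]
  · simp only [hform1, hform2, abs_le, ← forall_and]
    refine forall_congr' fun v => ?_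
    constructor <;> rintro ⟨h1, h2⟩ <;> constructor <;> linarith
  · intro a b
    rw [star_add, star_sub, star_mul, hrs, ← hGs, ← hDs, mul_comm]
  · intro a b
    rw [star_sub, star_sub, star_mul, hrs, ← hGs, ← hDs, mul_comm]

theorem sum_get_of_nodup {N : ℕ} {M : Type*} [AddCommMonoid M] {T : List (Fin N)} (hT : T.Nodup)
    (f : Fin N → M) (hf : ∀ i ∉ T, f i = 0) : ∑ a, f (T.get a) = ∑ i, f i := by
  rw [← Finset.sum_subset (Finset.subset_univ T.toFinset)
    (fun i _ hi => hf i (by simpa using hi))]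
  refine Finset.sum_bij (fun a _ => T.get a) (by simp) (fun a _ b _ h => ?_) (fun i hi => ?_)
    (fun _ _ => rfl)
  · exact List.nodup_iff_injective_get.1 hT h
  · obtain ⟨a, ha⟩ := List.get_of_mem (List.mem_toFinset.1 hi)
    exact ⟨a, Finset.mem_univ _, ha⟩

theorem deviation_columns {n N : ℕ} (Φ : Matrix (Fin n) (Fin N) ℂ) {T : List (Fin N)}
    (hT : T.Nodup) (x : Fin N → ℂ) (hx : ∀ i ∉ T, x i = 0) :
    deviation (columns Φ T) (fun a => x (T.get a)) = deviation Φ x ∧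
      sqNorm (fun a => x (T.get a)) = sqNorm x := by
  have h1 : sqNorm (fun a => x (T.get a)) = sqNorm x := by
    rw [sqNorm_eq_sum, sqNorm_eq_sum]
    exact sum_get_of_nodup hT (fun i => ‖x i‖ ^ 2) fun i hi => by simp [hx i hi]
  have h2 : columns Φ T *ᵥ (fun a => x (T.get a)) = Φ *ᵥ x := by
    ext l
    exact sum_get_of_nodup hT (fun i => Φ l i * x i) fun i hi => by simp [hx i hi]
  exact ⟨by rw [deviation, deviation, h1, h2], h1⟩

/-- Since m ≤ N, each m-sparse vector is supported in a set of exactly m columns; for m > N there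
would be nothing to test. -/
theorem allSubsets_subsetTest_val_iff {n N m : ℕ} (Φ : Matrix (Fin n) (Fin N) ℂ) (r : ℝ)
    (hm : m ≤ N) :
    (allSubsets (subsetTest Φ (r : ℂ)) (List.finRange N) m []).val = true ↔
      ∀ x, IsSparse m x → |deviation Φ x| ≤ r * sqNorm x := by
  classical
  simp only [allSubsets_val_iff, subsetTest_val_iff, List.append_nil]
  constructor
  · intro h x hx
    obtain ⟨S, hc, hS⟩ := hx.exists_finset hm
    set l := (List.finRange N).filter (· ∈ S) with hl
    have hlS : l.toFinset = S := by ext; simp [hl]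
    have hnd : l.Nodup := (List.nodup_finRange N).filter _
    have hlen : l.length = m := by rw [← List.toFinset_card_of_nodup hnd, hlS, hc]
    have hnd' : l.reverse.Nodup := List.nodup_reverse.2 hnd
    have hx' : ∀ i ∉ l.reverse, x i = 0 := fun i hi => hS i fun hiS => hi (by simp [hl, hiS])
    obtain ⟨e1, e2⟩ := deviation_columns Φ hnd' x hx'
    rw [← e1, ← e2]
    exact h l List.filter_sublist hlen _
  · intro h l hl hlen v
    have hnd : l.reverse.Nodup := List.nodup_reverse.2 (hl.nodup (List.nodup_finRange N))
    have hinj := List.nodup_iff_injective_get.1 hnd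
    -- Extension by zero turns a vector of the submatrix into a sparse vector of the whole space.
    set x : Fin N → ℂ := Function.extend l.reverse.get v 0 with hxdef
    have hv : (fun a => x (l.reverse.get a)) = v := funext fun a => hinj.extend_apply v 0 a
    have hx : ∀ i ∉ l.reverse, x i = 0 := by
      intro i hi
      rw [hxdef, Function.extend_apply']
      · rfl
      · rintro ⟨a, rfl⟩
        exact hi (List.get_mem _ _)
    obtain ⟨e1, e2⟩ := deviation_columns Φ hnd x hx
    rw [hv] at e1 e2
    rw [e1, e2]
    refine h x (isSparse_of_forall_notMem (S := l.reverse.toFinset) (fun i hi => hx i ?_) ?_)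
    · simpa using hi
    · rw [List.toFinset_card_of_nodup hnd, List.length_reverse, hlen]

theorem mem_lazyAlgorithm_iff {n N m : ℕ} (Φ : Matrix (Fin n) (Fin N) ℂ) {δ : ℝ} (hm : 2 ≤ m)
    (hδ : 0 ≤ δ) (k : ℕ) :
    k ∈ (lazyAlgorithm Φ m δ).val ↔
      m ≤ k ∧ k ≤ N ∧ ripParam Φ m * ((k : ℝ) - 1) / ((m : ℝ) - 1) ≤ δ := by
  have hr : ∀ k : ℕ, ((δ : ℂ) * ((m : ℂ) - 1)) / ((k : ℂ) - 1) =
      ((δ * ((m : ℝ) - 1) / ((k : ℝ) - 1) : ℝ) : ℂ) := fun k => by push_cast; rfl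
  have hsel : (lazyAlgorithm Φ m δ).val = (select (fun k => do
        let a ← minus (m : ℂ) 1
        let b ← minus (k : ℂ) 1
        let c ← times (δ : ℂ) a
        let r ← quotient c b
        allSubsets (subsetTest Φ r) (List.finRange N) m []) (List.range' m (N + 1 - m))).val := rfl
  rw [hsel, mem_select_val, List.mem_range'_1]
  simp only [val_bind, minus, times, quotient, val_step]
  rw [hr]
  by_cases hk : m ≤ k ∧ k ≤ N
  · have hm2 : (2 : ℝ) ≤ m := by exact_mod_cast hm
    have hk2 : (2 : ℝ) ≤ k := by exact_mod_cast hm.trans hk.1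
    have hm1 : 0 < (m : ℝ) - 1 := by linarith
    have hk1 : 0 < (k : ℝ) - 1 := by linarith
    rw [allSubsets_subsetTest_val_iff Φ _ (hk.1.trans hk.2), ← ripParam_le_iff Φ m (by positivity),
      le_div_iff₀ hk1, div_le_iff₀ hm1]
    constructor
    · rintro ⟨-, h⟩; exact ⟨hk.1, hk.2, h⟩
    · rintro ⟨-, -, h⟩; exact ⟨by omega, h⟩
  · constructor
    · rintro ⟨h, -⟩; omega
    · rintro ⟨h1, h2, -⟩; omega

/-- The coordinate-deletion bound with θ = ε/(m − 1). -/
theorem satisfiesRIP_of_ripParam_le {n N m k : ℕ} {Φ : Matrix (Fin n) (Fin N) ℂ} {δ : ℝ}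
    (hm : 2 ≤ m) (hΦ : HasUnitColumns Φ) (hk : m ≤ k)
    (h : ripParam Φ m * ((k : ℝ) - 1) / ((m : ℝ) - 1) ≤ δ) : SatisfiesRIP Φ k δ := by
  have hm2 : (2 : ℝ) ≤ m := by exact_mod_cast hm
  have hm1 : 0 < (m : ℝ) - 1 := by linarith
  have hθ : 0 ≤ ripParam Φ m / ((m : ℝ) - 1) := div_nonneg (ripParam_nonneg Φ m) hm1.le
  rw [satisfiesRIP_iff]
  intro x hx
  have h0 := sqNorm_nonneg x
  refine (abs_deviation_le_of_le hΦ hm hθ ?_ hk x hx).trans ?_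
  · rw [div_mul_cancel₀ _ hm1.ne']
    exact (ripParam_le_iff Φ m (ripParam_nonneg Φ m)).1 le_rfl
  · gcongr
    rwa [div_mul_eq_mul_div]

/-! ### Running time -/

theorem steps_fill_le {m c : ℕ} {f : Fin m → Fin m → Timed ℂ} (h : ∀ i j, (f i j).steps ≤ c) :
    (fill m f).steps ≤ m ^ 2 * (c + 2) + 1 := by
  simp only [fill]
  gcongr
  calc ∑ i, ∑ j, ((f i j).steps + 2) ≤ ∑ _i : Fin m, ∑ _j : Fin m, (c + 2) := by
        gcongr with i _ j _
        exact h i j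
    _ = m ^ 2 * (c + 2) := by simp; ring

/-- One elimination round is quadratic and is absorbed by the difference 8(m + 2)³ − 8(m + 1)³. -/
theorem steps_psdTest_le : ∀ (m : ℕ) (M : Fin m → Fin m → ℂ),
    (psdTest m M).steps ≤ 8 * (m + 1) ^ 3
  | 0, M => by simp [psdTest]
  | m + 1, M => by
    have hp : (isPos (M 0 0)).steps = 1 := rfl
    have hz : (isZero (M 0 0)).steps = 1 := rfl
    rw [psdTest]
    simp only [steps_bind, hp]
    split_ifs
    · simp only [steps_bind]
      refine (Nat.add_le_add_left (Nat.add_le_add (steps_fill_le (c := 3) fun i j => ?_)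
        (steps_psdTest_le m _)) 1).trans ?_
      · rfl
      · ring_nf; nlinarith
    · simp only [steps_bind, hz]
      split_ifs
      · have he : (every m fun i => isZero (M i.succ 0)).steps = m * 3 + 1 := by
          simp [every, isZero]
        simp only [steps_bind, he]
        split_ifs
        · simp only [steps_bind]
          refine (Nat.add_le_add_left (Nat.add_le_add_left (Nat.add_le_add_left
            (Nat.add_le_add (steps_fill_le (c := 1) fun i j => le_rfl)
              (steps_psdTest_le m _)) _) _) _).trans ?_
          ring_nf; nlinarith
        · simp only [steps_step]
          ring_nf; nlinarith
      · simp only [steps_step]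
        ring_nf; nlinarith

theorem steps_subsetTest_le {n N : ℕ} (Φ : Matrix (Fin n) (Fin N) ℂ) (r : ℂ) (T : List (Fin N))
    (hn : n ≤ N) (hT : T.length ≤ N) : (subsetTest Φ r T).steps ≤ 40 * (N + 1) ^ 3 := by
  rw [subsetTest]
  simp only [steps_bind, steps_step]
  -- A Gram entry takes 4n + 1 steps (conjugation, product and loop overhead per row), and
  -- subtracting the identity two more.
  refine (Nat.add_le_add (steps_fill_le (c := 4 * n + 3) fun a b => ?_)
    (Nat.add_le_add (steps_fill_le (c := 3) fun a b => le_rfl)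
      (Nat.add_le_add (steps_fill_le (c := 3) fun a b => le_rfl)
        (Nat.add_le_add (steps_psdTest_le _ _)
          (Nat.add_le_add_right (steps_psdTest_le _ _) 1))))).trans ?_
  · simp [total, conjugate, times, kronecker, minus]
    omega
  · generalize T.length = m at hT
    have h1 : m ^ 2 * (4 * n + 3 + 2) ≤ N ^ 2 * (4 * N + 3 + 2) := by gcongr
    have h2 : m ^ 2 * (3 + 2) ≤ N ^ 2 * (3 + 2) := by gcongr
    have h3 : 8 * (m + 1) ^ 3 ≤ 8 * (N + 1) ^ 3 := by gcongr
    ring_nf at h1 h2 h3 ⊢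
    nlinarith

/-- A branching call adds at most 3 steps of its own, so steps + 3 is subadditive along the
recursion. With q = `rest.length + 1` it closes by q^m + q^(m+1) = (q + 1)q^m ≤ (q + 1)^(m+1). -/
theorem steps_allSubsets_le {N W : ℕ} {test : List (Fin N) → Timed Bool} :
    ∀ (pool : List (Fin N)) (m : ℕ) (T : List (Fin N)),
      (∀ l : List (Fin N), l.length = m + T.length → (test l).steps ≤ W) →
        (allSubsets test pool m T).steps + 3 ≤ (W + 4) * (pool.length + 1) ^ m
  | pool, 0, T, h => by
    have : (allSubsets test pool 0 T).steps = 1 + (test T).steps := by cases pool <;> rfl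
    have := h T (by simp)
    simp
    omega
  | [], m + 1, T, h => by
    simp [allSubsets]
  | i :: rest, m + 1, T, h => by
    have h1 := steps_allSubsets_le rest m (i :: T) fun l hl => h l (by
      rw [hl, List.length_cons]; ring)
    have h2 := steps_allSubsets_le rest (m + 1) T h
    have h3 : (allSubsets test (i :: rest) (m + 1) T).steps ≤
        3 + (allSubsets test rest m (i :: T)).steps + (allSubsets test rest (m + 1) T).steps := by
      rw [allSubsets]
      simp only [steps_bind, steps_step, val_step]
      split_ifs
      · omega
      · simp only [steps_step]; omega
    calc (allSubsets test (i :: rest) (m + 1) T).steps + 3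
        ≤ (W + 4) * (rest.length + 1) ^ m + (W + 4) * (rest.length + 1) ^ (m + 1) := by omega
      _ = (W + 4) * ((rest.length + 1 + 1) * (rest.length + 1) ^ m) := by ring
      _ ≤ (W + 4) * ((rest.length + 1 + 1) * (rest.length + 1 + 1) ^ m) := by gcongr; omega
      _ = _ := by rw [List.length_cons]; ring

theorem steps_select_le {B : ℕ} {test : ℕ → Timed Bool} :
    ∀ {l : List ℕ}, (∀ k ∈ l, (test k).steps ≤ B) →
      (select test l).steps ≤ l.length * (B + 2) + 1
  | [], _ => by simp [select]
  | a :: l, h => by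
    have h1 := steps_select_le (test := test) (l := l) fun k hk => h k (List.mem_cons_of_mem _ hk)
    have h2 := h a List.mem_cons_self
    rw [select]
    simp only [steps_bind, steps_step, List.length_cons, add_mul]
    split_ifs <;> simp only [steps_step] <;> omega

theorem steps_lazyAlgorithm_le {n N : ℕ} (Φ : Matrix (Fin n) (Fin N) ℂ) (m : ℕ) (δ : ℝ)
    (hn : n ≤ N) : (lazyAlgorithm Φ m δ).steps ≤ 52 * (N + 1) ^ (m + 4) := by
  set test : ℕ → Timed Bool := fun k => do
        let a ← minus (m : ℂ) 1
        let b ← minus (k : ℂ) 1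
        let c ← times (δ : ℂ) a
        let r ← quotient c b
        allSubsets (subsetTest Φ r) (List.finRange N) m [] with htest
  have hsel : (lazyAlgorithm Φ m δ).steps =
      2 * N + 1 + (select test (List.range' m (N + 1 - m))).steps := rfl
  have h1 : ∀ k ∈ List.range' m (N + 1 - m),
      (test k).steps ≤ 4 + (40 * (N + 1) ^ 3 + 4) * (N + 1) ^ m := by
    intro k hk
    rw [List.mem_range'_1] at hk
    simp only [htest, minus, times, quotient, steps_bind, steps_step, val_step]
    have := steps_allSubsets_le (test := subsetTest Φ ((δ : ℂ) * ((m : ℂ) - 1) / ((k : ℂ) - 1)))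
      (W := 40 * (N + 1) ^ 3) (List.finRange N) m [] fun l hl =>
        steps_subsetTest_le Φ _ l hn (by rw [hl, List.length_nil]; omega)
    rw [List.length_finRange] at this
    omega
  have h2 := steps_select_le h1
  rw [List.length_range'] at h2
  rw [hsel]
  -- If m > N there is no order to test, and only writing the index array costs time.
  rcases Nat.eq_zero_or_pos (N + 1 - m) with h0 | h0
  · rw [h0] at h2 ⊢
    have : 1 ≤ (N + 1) ^ (m + 3) := Nat.one_le_pow _ _ (by omega)
    rw [show m + 4 = m + 3 + 1 by rfl, pow_succ]
    simp only [List.range'_zero] at h2 ⊢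
    nlinarith
  · have h3 : (N + 1 - m) ≤ N + 1 := by omega
    have h4 : 1 ≤ (N + 1) ^ m := Nat.one_le_pow _ _ (by omega)
    have h5 : 1 ≤ (N + 1) ^ 3 := Nat.one_le_pow _ _ (by omega)
    generalize hP : (N + 1) ^ m = P at *
    have e : (N + 1) ^ (m + 4) = (N + 1) * ((N + 1) ^ 3 * P) := by rw [← hP]; ring
    rw [e]
    generalize hQ : (N + 1) ^ 3 = Q at *
    have h6 : 1 ≤ Q * P := Nat.mul_pos h5 h4
    have h7 : P ≤ Q * P := Nat.le_mul_of_pos_left P h5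
    calc 2 * N + 1 + (select test (List.range' m (N + 1 - m))).steps
        ≤ 2 * N + 1 + ((N + 1) * (4 + (40 * Q + 4) * P + 2) + 1) := by
          gcongr
          exact h2.trans (by gcongr)
      _ = (N + 1) * (40 * (Q * P) + 4 * P + 8) := by ring
      _ ≤ (N + 1) * (52 * (Q * P)) := by gcongr; omega
      _ = _ := by ring

theorem one_lt_log_of_three_le {N : ℕ} (hN : 3 ≤ N) : 1 < Real.log N := by
  rw [Real.lt_log_iff_exp_lt (by positivity)]
  have : (3 : ℝ) ≤ N := by exact_mod_cast hN
  linarith [Real.exp_one_lt_d9]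

theorem steps_lazyAlgorithm_lazyOrder_le {n N : ℕ} (Φ : Matrix (Fin n) (Fin N) ℂ) (δ : ℝ)
    (hN : 3 ≤ N) (hn : n ≤ N) :
    ((lazyAlgorithm Φ (lazyOrder N) δ).steps : ℝ) ≤
      2 ^ ((16 / Real.log 2) * Real.log N ^ 4) := by
  set m := lazyOrder N with hm
  set L := Real.log N with hL
  have hL1 : 1 < L := one_lt_log_of_three_le hN
  have h1 : (lazyAlgorithm Φ m δ).steps ≤ N ^ (2 * m + 12) := by
    refine (steps_lazyAlgorithm_le Φ m δ hn).trans ?_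
    have h2 : N + 1 ≤ N ^ 2 := by nlinarith
    have h3 : 52 ≤ N ^ 4 := le_trans (by norm_num) (Nat.pow_le_pow_left hN 4)
    calc 52 * (N + 1) ^ (m + 4) ≤ N ^ 4 * (N ^ 2) ^ (m + 4) := by gcongr
      _ = N ^ (2 * m + 12) := by rw [← pow_mul, ← pow_add]; congr 1; ring
  have hNpos : (0 : ℝ) < N := by positivity
  have hmle : (m : ℝ) ≤ L ^ 3 + 1 := (Nat.ceil_lt_add_one (by positivity)).le
  have h3 : 1 ≤ L ^ 3 := one_le_pow₀ hL1.le
  have hlog2 : Real.log 2 ≠ 0 := (Real.log_pos one_lt_two).ne'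
  calc ((lazyAlgorithm Φ m δ).steps : ℝ) ≤ (N : ℝ) ^ (2 * m + 12) := by exact_mod_cast h1
    _ = Real.exp (L * (2 * m + 12)) := by
        rw [← Real.rpow_natCast, Real.rpow_def_of_pos hNpos]
        push_cast
        rfl
    -- From m ≤ L³ + 1 and L ≥ 1: 2m + 12 ≤ 2L³ + 14 ≤ 16L³.
    _ ≤ Real.exp (16 * L ^ 4) := by
        rw [Real.exp_le_exp]
        calc L * (2 * m + 12) ≤ L * (16 * L ^ 3) := by gcongr; linarith
          _ = 16 * L ^ 4 := by ring
    _ = 2 ^ ((16 / Real.log 2) * L ^ 4) := by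
        rw [Real.rpow_def_of_pos two_pos]
        congr 1
        field_simp

/-! ### Concentration for a fixed vector -/

section Concentration

variable {Ω : Type*} [MeasurableSpace Ω] {μ : Measure Ω}

/-- Writes exp(x²/4) as a Gaussian mixture of the exponentials exp(gx), so that bounds on a moment
generating function apply to squares. -/
theorem integral_exp_mul_sub_sq (x : ℝ) :
    Integrable (fun g : ℝ => Real.exp (g * x - g ^ 2)) ∧
      ∫ g : ℝ, Real.exp (g * x - g ^ 2) = √Real.pi * Real.exp (x ^ 2 / 4) := by
  have h : (fun g : ℝ => Real.exp (g * x - g ^ 2)) =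
      fun g => Real.exp (x ^ 2 / 4) * Real.exp (-1 * (g - x / 2) ^ 2) := by
    ext g
    rw [← Real.exp_add]
    congr 1
    ring
  rw [h]
  constructor
  · exact ((integrable_exp_neg_mul_sq one_pos).comp_sub_right (x / 2)).const_mul _
  · rw [integral_const_mul,
      integral_sub_right_eq_self (fun g : ℝ => Real.exp (-1 * g ^ 2)) (x / 2), integral_gaussian,
      div_one, mul_comm]

/-- Swap the mixture with the expectation: the subgaussian bound leaves ∫ exp(−g²/2) dg = √π·√2.
Working with `lintegral` makes integrability of exp(X²/4) a consequence rather than an assumption.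
-/
theorem lintegral_exp_sq_div_four_le [IsProbabilityMeasure μ] {X : Ω → ℝ}
    (hX : HasSubgaussianMGF X 1 μ) :
    ∫⁻ ω, ENNReal.ofReal (Real.exp (X ω ^ 2 / 4)) ∂μ ≤ ENNReal.ofReal √2 := by
  have hXm : AEMeasurable X μ := hX.aemeasurable
  have hpi : 0 < √Real.pi := Real.sqrt_pos.2 Real.pi_pos
  have h1 : ∀ x : ℝ, ENNReal.ofReal √Real.pi * ENNReal.ofReal (Real.exp (x ^ 2 / 4)) =
      ∫⁻ g : ℝ, ENNReal.ofReal (Real.exp (g * x - g ^ 2)) := by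
    intro x
    obtain ⟨hi, he⟩ := integral_exp_mul_sub_sq x
    rw [← ofReal_integral_eq_lintegral_ofReal hi (ae_of_all _ fun g => (Real.exp_pos _).le), he,
      ENNReal.ofReal_mul hpi.le]
  have h2 : ∀ g : ℝ, ∫⁻ ω, ENNReal.ofReal (Real.exp (g * X ω - g ^ 2)) ∂μ ≤
      ENNReal.ofReal (Real.exp (-(1 / 2) * g ^ 2)) := by
    intro g
    have he : ∀ ω, Real.exp (g * X ω - g ^ 2) = Real.exp (-g ^ 2) * Real.exp (g * X ω) := by
      intro ω
      rw [← Real.exp_add]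
      congr 1
      ring
    simp only [he]
    rw [← ofReal_integral_eq_lintegral_ofReal ((hX.integrable_exp_mul g).const_mul _)
      (ae_of_all _ fun ω => by positivity), integral_const_mul]
    refine ENNReal.ofReal_le_ofReal ?_
    have := hX.mgf_le g
    rw [mgf] at this
    calc Real.exp (-g ^ 2) * ∫ ω, Real.exp (g * X ω) ∂μ
        ≤ Real.exp (-g ^ 2) * Real.exp (((1 : NNReal) : ℝ) * g ^ 2 / 2) := by gcongr
      _ = _ := by
        rw [← Real.exp_add]
        congr 1
        push_cast
        ring
  have h3 : ENNReal.ofReal √Real.pi * ∫⁻ ω, ENNReal.ofReal (Real.exp (X ω ^ 2 / 4)) ∂μ ≤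
      ENNReal.ofReal √Real.pi * ENNReal.ofReal √2 := by
    rw [← lintegral_const_mul' _ _ ENNReal.ofReal_ne_top]
    simp only [h1]
    rw [lintegral_lintegral_swap]
    · refine (lintegral_mono h2).trans_eq ?_
      rw [← ofReal_integral_eq_lintegral_ofReal (integrable_exp_neg_mul_sq (by norm_num))
        (ae_of_all _ fun g => (Real.exp_pos _).le), integral_gaussian,
        ← ENNReal.ofReal_mul hpi.le, ← Real.sqrt_mul Real.pi_pos.le]
      congr 2
      ring
    · have hm : AEMeasurable (fun p : Ω × ℝ => X p.1) (μ.prod volume) :=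
        hXm.comp_quasiMeasurePreserving Measure.quasiMeasurePreserving_fst
      have hs : AEMeasurable (fun p : Ω × ℝ => p.2) (μ.prod volume) := measurable_snd.aemeasurable
      exact (((hs.mul hm).sub (hs.pow_const 2)).exp).ennreal_ofReal
  exact (ENNReal.mul_le_mul_iff_right (by simpa using Real.pi_pos) ENNReal.ofReal_ne_top).1 h3

theorem exp_le_one_add_add_sq_mul_exp_abs {u : ℝ} : Real.exp u ≤ 1 + u + u ^ 2 * Real.exp |u| := by
  have h := Complex.norm_exp_sub_sum_le_norm_mul_exp (u : ℂ) 2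
  have e : Complex.exp u - ∑ m ∈ Finset.range 2, (u : ℂ) ^ m / (m.factorial : ℂ) =
      ((Real.exp u - (1 + u) : ℝ) : ℂ) := by
    simp [Finset.sum_range_succ]
  rw [e, Complex.norm_real, Complex.norm_real, Real.norm_eq_abs, Real.norm_eq_abs, sq_abs] at h
  linarith [le_abs_self (Real.exp u - (1 + u))]

/-- Second-order Taylor remainder: x⁴ ≤ 128 exp(x²/8) handles the square, and |t| ≤ 1/8 bounds the
remaining exponential by another exp(x²/8). -/
theorem exp_mul_sq_le {t x : ℝ} (ht : |t| ≤ 1 / 8) :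
    Real.exp (t * x ^ 2) ≤ 1 + t * x ^ 2 + 128 * t ^ 2 * Real.exp (x ^ 2 / 4) := by
  refine exp_le_one_add_add_sq_mul_exp_abs.trans ?_
  have h1 : |t * x ^ 2| ≤ x ^ 2 / 8 := by
    rw [abs_mul, abs_of_nonneg (sq_nonneg x)]
    nlinarith [sq_nonneg x]
  have h2 : (x ^ 2 / 8) ^ 2 / 2 ≤ Real.exp (x ^ 2 / 8) := by
    have := Real.quadratic_le_exp_of_nonneg (x := x ^ 2 / 8) (by positivity)
    have : 0 ≤ x ^ 2 / 8 := by positivity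
    linarith
  have h3 : Real.exp (x ^ 2 / 4) = Real.exp (x ^ 2 / 8) * Real.exp (x ^ 2 / 8) := by
    rw [← Real.exp_add]; congr 1; ring
  rw [h3]
  have h4 : (t * x ^ 2) ^ 2 * Real.exp |t * x ^ 2| ≤
      128 * t ^ 2 * (Real.exp (x ^ 2 / 8) * Real.exp (x ^ 2 / 8)) := by
    calc (t * x ^ 2) ^ 2 * Real.exp |t * x ^ 2|
        = 128 * t ^ 2 * ((x ^ 2 / 8) ^ 2 / 2 * Real.exp |t * x ^ 2|) := by ring
      _ ≤ _ := by gcongr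
  linarith

/-- Integrating the Taylor bound, the linear term is cancelled by centering at the mean s, and only
the quadratic term, with E exp(X²/4) ≤ 2, remains. -/
theorem mgf_sq_sub_le [IsProbabilityMeasure μ] {X : Ω → ℝ} {s t : ℝ}
    (hX : HasSubgaussianMGF X 1 μ) (hs : ∫ ω, X ω ^ 2 ∂μ = s) (ht : |t| ≤ 1 / 8) :
    mgf (fun ω => X ω ^ 2 - s) μ t ≤ Real.exp (256 * t ^ 2) := by
  have hi2 : Integrable (fun ω => X ω ^ 2) μ := (hX.memLp 2).integrable_sq
  have hl := lintegral_exp_sq_div_four_le hX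
  have hie : Integrable (fun ω => Real.exp (X ω ^ 2 / 4)) μ := by
    refine ⟨((hX.aemeasurable.pow_const 2).div_const 4).exp.aestronglyMeasurable, ?_⟩
    rw [hasFiniteIntegral_iff_ofReal (ae_of_all _ fun ω => (Real.exp_pos _).le)]
    exact hl.trans_lt ENNReal.ofReal_lt_top
  have hE : ∫ ω, Real.exp (X ω ^ 2 / 4) ∂μ ≤ 2 := by
    rw [← ofReal_integral_eq_lintegral_ofReal hie (ae_of_all _ fun ω => (Real.exp_pos _).le),
      ENNReal.ofReal_le_ofReal_iff (by positivity)] at hl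
    refine hl.trans ?_
    rw [Real.sqrt_le_left (by norm_num)]
    norm_num
  have hi1 : Integrable (fun ω => 1 + t * X ω ^ 2) μ :=
    (integrable_const 1).add (hi2.const_mul t)
  have hfi : Integrable (fun ω => 1 + t * X ω ^ 2 + 128 * t ^ 2 * Real.exp (X ω ^ 2 / 4)) μ :=
    hi1.add (hie.const_mul _)
  have h1 : ∫ ω, Real.exp (t * X ω ^ 2) ∂μ ≤ 1 + t * s + 256 * t ^ 2 := by
    calc ∫ ω, Real.exp (t * X ω ^ 2) ∂μ
        ≤ ∫ ω, (1 + t * X ω ^ 2 + 128 * t ^ 2 * Real.exp (X ω ^ 2 / 4)) ∂μ :=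
          integral_mono_of_nonneg (ae_of_all _ fun ω => (Real.exp_pos _).le) hfi
            (ae_of_all _ fun ω => exp_mul_sq_le ht)
      _ = 1 + t * s + 128 * t ^ 2 * ∫ ω, Real.exp (X ω ^ 2 / 4) ∂μ := by
          rw [integral_add hi1 (hie.const_mul _),
            integral_add (integrable_const 1) (hi2.const_mul t), integral_const_mul,
            integral_const_mul, hs]
          simp
      _ ≤ 1 + t * s + 128 * t ^ 2 * 2 := by gcongr
      _ = _ := by ring
  rw [mgf]
  have he : ∀ ω, Real.exp (t * (X ω ^ 2 - s)) = Real.exp (-(t * s)) * Real.exp (t * X ω ^ 2) := by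
    intro ω
    rw [← Real.exp_add]; congr 1; ring
  simp only [he]
  rw [integral_const_mul]
  calc Real.exp (-(t * s)) * ∫ ω, Real.exp (t * X ω ^ 2) ∂μ
      ≤ Real.exp (-(t * s)) * Real.exp (t * s + 256 * t ^ 2) := by
        gcongr
        refine h1.trans ?_
        linarith [Real.add_one_le_exp (t * s + 256 * t ^ 2)]
    _ = _ := by rw [← Real.exp_add]; congr 1; ring

variable {n N : ℕ} {A : Ω → Matrix (Fin n) (Fin N) ℝ}

namespace IsBernoulliMatrix

theorem ae_eq_one_or [IsProbabilityMeasure μ] (h : IsBernoulliMatrix μ A) :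
    ∀ᵐ ω ∂μ, ∀ i j, A ω i j = 1 ∨ A ω i j = -1 := by
  rw [ae_all_iff]; intro i
  rw [ae_all_iff]; intro j
  have hm1 : MeasurableSet {ω | A ω i j = 1} := h.measurable i j (measurableSet_singleton 1)
  have hm2 : MeasurableSet {ω | A ω i j = -1} := h.measurable i j (measurableSet_singleton (-1))
  have hd : Disjoint {ω | A ω i j = 1} {ω | A ω i j = -1} := by
    rw [Set.disjoint_left]
    intro ω h1 h2
    simp only [Set.mem_ofPred_eq] at h1 h2
    rw [h1] at h2
    norm_num at h2
  have hu : μ ({ω | A ω i j = 1} ∪ {ω | A ω i j = -1}) = 1 := by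
    rw [measure_union hd hm2, h.prob_one, h.prob_neg_one, ENNReal.add_halves]
  exact (mem_ae_iff_prob_eq_one (hm1.union hm2)).2 hu

theorem integral_entry [IsProbabilityMeasure μ] (h : IsBernoulliMatrix μ A) (i : Fin n)
    (j : Fin N) : ∫ ω, A ω i j ∂μ = 0 := by
  have hm1 : MeasurableSet {ω | A ω i j = 1} := h.measurable i j (measurableSet_singleton 1)
  have hm2 : MeasurableSet {ω | A ω i j = -1} := h.measurable i j (measurableSet_singleton (-1))
  have he : (fun ω => A ω i j) =ᵐ[μ] fun ω =>
      {ω | A ω i j = 1}.indicator (fun _ => (1 : ℝ)) ω -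
        {ω | A ω i j = -1}.indicator (fun _ => (1 : ℝ)) ω := by
    filter_upwards [h.ae_eq_one_or] with ω hω
    rcases hω i j with h1 | h1 <;> simp [Set.indicator, h1] <;> norm_num
  rw [integral_congr_ae he, integral_sub, integral_indicator_const _ hm1,
    integral_indicator_const _ hm2, Measure.real, Measure.real, h.prob_one, h.prob_neg_one, sub_self]
  · exact (integrable_const 1).indicator hm1
  · exact (integrable_const 1).indicator hm2

theorem hasSubgaussianMGF_entry [IsProbabilityMeasure μ] (h : IsBernoulliMatrix μ A) (i : Fin n)
    (j : Fin N) : HasSubgaussianMGF (fun ω => A ω i j) 1 μ := by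
  have hb : ∀ᵐ ω ∂μ, A ω i j ∈ Set.Icc (-1 : ℝ) 1 := by
    filter_upwards [h.ae_eq_one_or] with ω hω
    rcases hω i j with h1 | h1 <;> rw [h1] <;> norm_num
  have := hasSubgaussianMGF_of_mem_Icc_of_integral_eq_zero (h.measurable i j).aemeasurable hb
    (h.integral_entry i j)
  convert this using 1
  norm_num

theorem indep_row (h : IsBernoulliMatrix μ A) (l : Fin n) (y : Fin N → ℝ) :
    iIndepFun (fun (j : Fin N) ω => A ω l j * y j) μ :=
  (h.indep.precomp (g := fun j : Fin N => (l, j)) fun _ _ hab => (Prod.ext_iff.1 hab).2).comp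
    (fun j x => x * y j) fun _ => measurable_id.mul_const _

/-- Hoeffding's lemma gives each entry parameter 1, and independence adds the parameters y_j², whose
sum is at most 1. -/
theorem hasSubgaussianMGF_mulVec [IsProbabilityMeasure μ] (h : IsBernoulliMatrix μ A) (l : Fin n)
    {y : Fin N → ℝ} (hy : ∑ j, y j ^ 2 ≤ 1) :
    HasSubgaussianMGF (fun ω => (A ω *ᵥ y) l) 1 μ := by
  have h1 : ∀ j ∈ Finset.univ, HasSubgaussianMGF (fun ω => A ω l j * y j)
      (⟨y j ^ 2, sq_nonneg _⟩ * 1) μ := by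
    intro j _
    convert (h.hasSubgaussianMGF_entry l j).const_mul (y j) using 1
    ext ω
    ring
  have h2 := HasSubgaussianMGF.sum_of_iIndepFun (h.indep_row l y) h1
  refine ⟨h2.integrable_exp_mul, fun t => (h2.mgf_le t).trans ?_⟩
  rw [Real.exp_le_exp]
  have : ((∑ j, (⟨y j ^ 2, sq_nonneg _⟩ * 1 : NNReal) : NNReal) : ℝ) ≤ ((1 : NNReal) : ℝ) := by
    rw [NNReal.coe_sum, NNReal.coe_one]
    exact (Finset.sum_congr rfl fun j _ => mul_one (y j ^ 2)).trans_le hy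
  gcongr

theorem integral_mulVec_sq [IsProbabilityMeasure μ] (h : IsBernoulliMatrix μ A) (l : Fin n)
    (y : Fin N → ℝ) : ∫ ω, (A ω *ᵥ y) l ^ 2 ∂μ = ∑ j, y j ^ 2 := by
  have hLp : ∀ j, MemLp (fun ω => A ω l j * y j) 2 μ := fun j =>
    ((h.hasSubgaussianMGF_entry l j).memLp 2).mul_const (y j)
  have hint : ∀ j, ∫ ω, A ω l j * y j ∂μ = 0 := fun j => by
    rw [integral_mul_const, h.integral_entry, zero_mul]
  have h1 := IndepFun.variance_sum (s := Finset.univ) (fun j _ => hLp j)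
    fun i _ j _ hij => (h.indep_row l y).indepFun hij
  have h2 : (∑ j, fun ω => A ω l j * y j) = fun ω => (A ω *ᵥ y) l := by
    ext ω
    simp [Matrix.mulVec, dotProduct]
  have h3 : ∀ j, variance (fun ω => A ω l j * y j) μ = y j ^ 2 := by
    intro j
    rw [variance_of_integral_eq_zero (hLp j).aestronglyMeasurable.aemeasurable (hint j)]
    have : (fun ω => (A ω l j * y j) ^ 2) =ᵐ[μ] fun _ => y j ^ 2 := by
      filter_upwards [h.ae_eq_one_or] with ω hω
      rcases hω l j with h1 | h1 <;> rw [h1] <;> ring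
    rw [integral_congr_ae this]
    simp
  have h4 : ∫ ω, (A ω *ᵥ y) l ∂μ = 0 := by
    change ∫ ω, ∑ j, A ω l j * y j ∂μ = 0
    rw [integral_finsetSum _ fun j _ => (hLp j).integrable (by norm_num)]
    simp [hint]
  rw [h2, variance_of_integral_eq_zero, Finset.sum_congr rfl fun j _ => h3 j] at h1
  · exact h1
  · rw [← h2]
    exact Finset.aemeasurable_sum _ fun j _ => (hLp j).aestronglyMeasurable.aemeasurable
  · exact h4

theorem measurable_mulVec (h : IsBernoulliMatrix μ A) (l : Fin n) (y : Fin N → ℝ) :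
    Measurable fun ω => (A ω *ᵥ y) l := by
  simp only [Matrix.mulVec, dotProduct]
  exact Finset.measurable_sum _ fun j _ => (h.measurable l j).mul_const _

/-- Distinct rows use disjoint blocks of the independent entries, so functions of them are
independent and the generating functions multiply. -/
theorem mgf_sum_rows [IsProbabilityMeasure μ] (h : IsBernoulliMatrix μ A) (y : Fin N → ℝ)
    {g : ℝ → ℝ} (hg : Measurable g) (t : ℝ) (s : Finset (Fin n)) :
    mgf (fun ω => ∑ l ∈ s, g ((A ω *ᵥ y) l)) μ t =
      ∏ l ∈ s, mgf (fun ω => g ((A ω *ᵥ y) l)) μ t := by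
  classical
  have hm : ∀ l, Measurable fun ω => g ((A ω *ᵥ y) l) := fun l => hg.comp (h.measurable_mulVec l y)
  induction s using Finset.induction_on with
  | empty => simp [mgf]
  | insert l s hl ih =>
    have hind : IndepFun (fun ω => g ((A ω *ᵥ y) l)) (fun ω => ∑ i ∈ s, g ((A ω *ᵥ y) i)) μ := by
      have hd : Disjoint (({l} : Finset (Fin n)) ×ˢ (Finset.univ : Finset (Fin N)))
          (s ×ˢ Finset.univ) := by
        rw [Finset.disjoint_left]
        simp only [Finset.mem_product, Finset.mem_singleton]
        rintro ⟨a, b⟩ ⟨rfl, -⟩ ⟨h2, -⟩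
        exact hl h2
      have h0 := h.indep.indepFun_finset _ _ hd fun p => h.measurable p.1 p.2
      have hφ : Measurable fun v : (({l} : Finset (Fin n)) ×ˢ (Finset.univ : Finset (Fin N)) :
          Finset (Fin n × Fin N)) → ℝ => g (∑ j, v ⟨(l, j), by simp⟩ * y j) :=
        hg.comp (Finset.measurable_sum _ fun j _ => (measurable_pi_apply _).mul_const _)
      have hψ : Measurable fun v : (s ×ˢ (Finset.univ : Finset (Fin N)) :
          Finset (Fin n × Fin N)) → ℝ =>
            ∑ i : s, g (∑ j, v ⟨(i.1, j), by simp⟩ * y j) :=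
        Finset.measurable_sum _ fun i _ =>
          hg.comp (Finset.measurable_sum _ fun j _ => (measurable_pi_apply _).mul_const _)
      convert h0.comp hφ hψ using 1
      · rfl
      ext ω
      exact (Finset.sum_coe_sort s fun i => g ((A ω *ᵥ y) i)).symm
    have he : (fun ω => ∑ i ∈ insert l s, g ((A ω *ᵥ y) i)) =
        (fun ω => g ((A ω *ᵥ y) l)) + fun ω => ∑ i ∈ s, g ((A ω *ᵥ y) i) := by
      ext ω
      simp [Finset.sum_insert hl]
    rw [he, hind.mgf_add, Finset.prod_insert hl, ih]
    · exact ((hm l).const_mul t).exp.aestronglyMeasurable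
    · exact ((Finset.measurable_sum _ fun i _ => hm i).const_mul t).exp.aestronglyMeasurable

theorem integrable_exp_sum_rows [IsProbabilityMeasure μ] (h : IsBernoulliMatrix μ A)
    (y : Fin N → ℝ) (s t : ℝ) :
    Integrable (fun ω => Real.exp (t * ∑ l, ((A ω *ᵥ y) l ^ 2 - s))) μ := by
  have hm : Measurable fun ω => ∑ l, ((A ω *ᵥ y) l ^ 2 - s) :=
    Finset.measurable_sum _ fun l _ => ((h.measurable_mulVec l y).pow_const 2).sub_const s
  refine integrable_exp_mul_of_mem_Icc (a := -(n * ((∑ j, |y j|) ^ 2 + |s|)))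
    (b := n * ((∑ j, |y j|) ^ 2 + |s|)) hm.aemeasurable ?_
  filter_upwards [h.ae_eq_one_or] with ω hω
  rw [Set.mem_Icc, ← abs_le]
  refine (Finset.abs_sum_le_sum_abs _ _).trans ?_
  have : ∀ l ∈ Finset.univ, |(A ω *ᵥ y) l ^ 2 - s| ≤ (∑ j, |y j|) ^ 2 + |s| := by
    intro l _
    refine (norm_sub_le ((A ω *ᵥ y) l ^ 2) s).trans ?_
    rw [Real.norm_eq_abs, Real.norm_eq_abs, abs_pow]
    gcongr
    change |∑ j, A ω l j * y j| ≤ _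
    refine (Finset.abs_sum_le_sum_abs _ _).trans (Finset.sum_le_sum fun j _ => ?_)
    rw [abs_mul]
    rcases hω l j with h1 | h1 <;> rw [h1] <;> simp
  refine (Finset.sum_le_sum this).trans ?_
  simp [mul_add]

/-- Concentration of the squared norm of the image of a fixed vector. -/
theorem measureReal_abs_sum_ge_le [IsProbabilityMeasure μ] (h : IsBernoulliMatrix μ A)
    {y : Fin N → ℝ} (hy : ∑ j, y j ^ 2 ≤ 1) {τ : ℝ} (hτ : 0 ≤ τ) (hτ1 : τ ≤ 1) :
    μ.real {ω | n * τ ≤ |∑ l, ((A ω *ᵥ y) l ^ 2 - ∑ j, y j ^ 2)|} ≤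
      2 * Real.exp (-(n * τ ^ 2 / 1024)) := by
  set s := ∑ j, y j ^ 2 with hs
  set Z : Ω → ℝ := fun ω => ∑ l, ((A ω *ᵥ y) l ^ 2 - s) with hZ
  have hmgf : ∀ t : ℝ, |t| ≤ 1 / 8 → mgf Z μ t ≤ Real.exp (n * (256 * t ^ 2)) := by
    intro t ht
    rw [hZ, h.mgf_sum_rows y (g := fun x => x ^ 2 - s) (by fun_prop) t Finset.univ]
    refine (Finset.prod_le_prod (g := fun _ => Real.exp (256 * t ^ 2)) (fun l _ => mgf_nonneg)
      fun l _ => ?_).trans_eq ?_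
    · exact mgf_sq_sub_le (h.hasSubgaussianMGF_mulVec l hy) (h.integral_mulVec_sq l y) ht
    · rw [Finset.prod_const, Finset.card_univ, Fintype.card_fin, ← Real.exp_nat_mul]
  have hsplit : {ω | n * τ ≤ |Z ω|} ⊆ {ω | n * τ ≤ Z ω} ∪ {ω | Z ω ≤ -(n * τ)} := by
    intro ω hω
    rcases le_abs.1 (show n * τ ≤ |Z ω| from hω) with h1 | h1
    · exact Or.inl h1
    · exact Or.inr (show Z ω ≤ -(n * τ) by linarith)
  -- t = τ/512 minimises 256t² − tτ, with value −τ²/1024; τ ≤ 1 keeps it in the admissible range.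
  have ht : |τ / 512| ≤ 1 / 8 := by rw [abs_of_nonneg (by positivity)]; linarith
  have hup : μ.real {ω | n * τ ≤ Z ω} ≤ Real.exp (-(n * τ ^ 2 / 1024)) := by
    refine (measure_ge_le_exp_mul_mgf (t := τ / 512) _ (by positivity)
      (h.integrable_exp_sum_rows y s _)).trans ?_
    refine (mul_le_mul_of_nonneg_left (hmgf _ ht) (Real.exp_pos _).le).trans_eq ?_
    rw [← Real.exp_add]
    congr 1
    ring
  have hlow : μ.real {ω | Z ω ≤ -(n * τ)} ≤ Real.exp (-(n * τ ^ 2 / 1024)) := by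
    refine (measure_le_le_exp_mul_mgf (t := -(τ / 512)) _ (by
      rw [neg_nonpos]; positivity) (h.integrable_exp_sum_rows y s _)).trans ?_
    refine (mul_le_mul_of_nonneg_left (hmgf _ (by rwa [abs_neg])) (Real.exp_pos _).le).trans_eq ?_
    rw [← Real.exp_add]
    congr 1
    ring
  calc μ.real {ω | n * τ ≤ |Z ω|} ≤ μ.real ({ω | n * τ ≤ Z ω} ∪ {ω | Z ω ≤ -(n * τ)}) :=
        measureReal_mono hsplit
    _ ≤ _ := measureReal_union_le _ _
    _ ≤ _ := by linarith

end IsBernoulliMatrix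

end Concentration

/-! ### Discretization of the unit ball -/

/-- The deviation of a real matrix, scaled by its number of rows. -/
def realDeviation {n N : ℕ} (B : Matrix (Fin n) (Fin N) ℝ) (x : Fin N → ℝ) : ℝ :=
  ∑ l, ((B *ᵥ x) l ^ 2 - ∑ j, x j ^ 2)

theorem realDeviation_smul {n N : ℕ} (B : Matrix (Fin n) (Fin N) ℝ) (c : ℝ) (x : Fin N → ℝ) :
    realDeviation B (c • x) = c ^ 2 * realDeviation B x := by
  simp only [realDeviation, Matrix.mulVec_smul, Pi.smul_apply, smul_eq_mul, Finset.mul_sum,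
    mul_pow, mul_sub]

/-- Rounding towards zero, not to the nearest point, so that grid approximations stay in the unit
ball and keep zero coordinates. -/
theorem exists_int_div_near (x : ℝ) {L : ℝ} (hL : 0 < L) :
    ∃ z : ℤ, |(z : ℝ) / L| ≤ |x| ∧ |x - z / L| ≤ 1 / L := by
  have key : ∀ x : ℝ, 0 ≤ x → ∃ z : ℤ, |(z : ℝ) / L| ≤ |x| ∧ |x - z / L| ≤ 1 / L := by
    intro x hx
    have h1 := Int.floor_le (x * L)
    have h2 := (Int.lt_floor_add_one (x * L)).le
    have h3 : (0 : ℝ) ≤ ⌊x * L⌋ := by exact_mod_cast Int.floor_nonneg.2 (by positivity)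
    have h4 : (⌊x * L⌋ : ℝ) / L ≤ x := (div_le_iff₀ hL).2 h1
    refine ⟨⌊x * L⌋, ?_, ?_⟩
    · rwa [abs_of_nonneg (by positivity), abs_of_nonneg hx]
    · rw [abs_of_nonneg (by linarith), sub_le_iff_le_add, ← add_div, le_div_iff₀ hL]
      linarith
  rcases le_total 0 x with hx | hx
  · exact key x hx
  · obtain ⟨z, h1, h2⟩ := key (-x) (by linarith)
    refine ⟨-z, ?_, ?_⟩
    · push_cast
      rw [neg_div, abs_neg]
      rwa [abs_neg] at h1
    · push_cast
      rw [← abs_neg]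
      convert h2 using 2
      ring

open Classical in
/-- The vectors `z` of integers that are supported in `T` and for which `z / L` lies in the
unit ball. -/
def gridVectors {N : ℕ} (L : ℕ) (T : Finset (Fin N)) : Finset (Fin N → ℤ) :=
  (Fintype.piFinset fun j => if j ∈ T then Finset.Icc (-(L : ℤ)) L else {0}).filter
    fun z => ∑ j, ((z j : ℝ) / L) ^ 2 ≤ 1

theorem card_gridVectors_le {N : ℕ} (L : ℕ) (T : Finset (Fin N)) :
    (gridVectors L T).card ≤ (2 * L + 1) ^ T.card := by
  classical
  refine (Finset.card_filter_le _ _).trans_eq ?_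
  rw [Fintype.card_piFinset]
  simp only [apply_ite Finset.card, Int.card_Icc, Finset.card_singleton]
  rw [Finset.prod_ite, Finset.prod_const, Finset.prod_const_one, mul_one]
  congr 1
  · omega
  · congr 1
    ext; simp

theorem exists_gridVectors_near {N L : ℕ} (hL : 0 < L) {T : Finset (Fin N)} {x : Fin N → ℝ}
    (hT : ∀ j ∉ T, x j = 0) (hx : ∑ j, x j ^ 2 ≤ 1) :
    ∃ z ∈ gridVectors L T, ∀ j, |(z j : ℝ) / L| ≤ |x j| ∧ |x j - z j / L| ≤ 1 / L := by
  classical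
  have hL' : (0 : ℝ) < L := by exact_mod_cast hL
  choose z hz using fun j => exists_int_div_near (x j) hL'
  refine ⟨z, ?_, hz⟩
  rw [gridVectors, Finset.mem_filter, Fintype.mem_piFinset]
  refine ⟨fun j => ?_, (Finset.sum_le_sum fun j _ => sq_le_sq.2 (hz j).1).trans hx⟩
  have hxj : |x j| ≤ 1 := by
    rw [← sq_le_one_iff_abs_le_one]
    exact (Finset.single_le_sum (fun i _ => sq_nonneg (x i)) (Finset.mem_univ j)).trans hx
  split_ifs with hj
  · have h1 := (hz j).1.trans hxj
    rw [abs_div, abs_of_pos hL', div_le_one hL'] at h1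
    rw [Finset.mem_Icc, ← abs_le]
    exact_mod_cast h1
  · have h1 := (hz j).1
    rw [hT j hj, abs_zero, abs_nonpos_iff, div_eq_zero_iff, or_iff_left hL'.ne'] at h1
    rw [Finset.mem_singleton]
    exact_mod_cast h1

/-- Crude coordinatewise estimates suffice: a loss polynomial in N is paid for by a polynomially
finer grid. -/
theorem abs_realDeviation_sub_le {n N : ℕ} {B : Matrix (Fin n) (Fin N) ℝ}
    (hB : ∀ i j, |B i j| ≤ 1) {x y : Fin N → ℝ} {η : ℝ} (hx : ∀ j, |x j| ≤ 1)
    (hyx : ∀ j, |y j| ≤ |x j|) (hη : ∀ j, |x j - y j| ≤ η) :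
    |realDeviation B x - realDeviation B y| ≤ n * (2 * (N ^ 2 + N) * η) := by
  have hadd : ∀ j, |x j + y j| ≤ 2 := fun j =>
    (abs_add_le _ _).trans (by linarith [hx j, hyx j])
  have hsum : ∀ (l : Fin n) (v : Fin N → ℝ) (c : ℝ), (∀ j, |v j| ≤ c) → |(B *ᵥ v) l| ≤ N * c := by
    intro l v c hv
    change |∑ j, B l j * v j| ≤ _
    refine (Finset.abs_sum_le_sum_abs _ _).trans ?_
    calc ∑ j, |B l j * v j| ≤ ∑ _j : Fin N, 1 * c := by
          refine Finset.sum_le_sum fun j _ => ?_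
          rw [abs_mul]
          exact mul_le_mul (hB l j) (hv j) (abs_nonneg _) zero_le_one
      _ = N * c := by simp
  have hsq : |∑ j, x j ^ 2 - ∑ j, y j ^ 2| ≤ N * (2 * η) := by
    rw [← Finset.sum_sub_distrib]
    refine (Finset.abs_sum_le_sum_abs _ _).trans ?_
    calc ∑ j, |x j ^ 2 - y j ^ 2| ≤ ∑ _j : Fin N, 2 * η := by
          refine Finset.sum_le_sum fun j _ => ?_
          rw [sq_sub_sq, abs_mul]
          exact mul_le_mul (hadd j) (hη j) (abs_nonneg _) zero_le_two
      _ = N * (2 * η) := by simp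
  have hrow : ∀ l, |(B *ᵥ x) l ^ 2 - (B *ᵥ y) l ^ 2| ≤ (N * 2) * (N * η) := by
    intro l
    rw [sq_sub_sq, abs_mul, ← Pi.add_apply, ← Matrix.mulVec_add, ← Pi.sub_apply,
      ← Matrix.mulVec_sub]
    exact mul_le_mul (hsum l _ 2 hadd) (hsum l _ η hη) (abs_nonneg _) (by positivity)
  rw [realDeviation, realDeviation, ← Finset.sum_sub_distrib]
  refine (Finset.abs_sum_le_sum_abs _ _).trans ?_
  calc ∑ l, |(B *ᵥ x) l ^ 2 - ∑ j, x j ^ 2 - ((B *ᵥ y) l ^ 2 - ∑ j, y j ^ 2)|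
      ≤ ∑ _l : Fin n, (2 * (N ^ 2 + N) * η) := by
        refine Finset.sum_le_sum fun l _ => ?_
        rw [sub_sub_sub_comm]
        refine (norm_sub_le ((B *ᵥ x) l ^ 2 - (B *ᵥ y) l ^ 2) _).trans ?_
        have := add_le_add (hrow l) hsq
        rw [Real.norm_eq_abs, Real.norm_eq_abs]
        linarith
    _ = _ := by simp

theorem abs_realDeviation_le_of_grid {n N : ℕ} {B : Matrix (Fin n) (Fin N) ℝ}
    (hB : ∀ i j, |B i j| ≤ 1) {T : Finset (Fin N)} (hN : 0 < N) {t : ℝ} (ht : 1 / N ≤ t)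
    (h : ∀ z ∈ gridVectors (8 * N ^ 3) T,
      |realDeviation B fun j => (z j : ℝ) / (8 * N ^ 3 : ℕ)| ≤ n * (t / 2))
    {x : Fin N → ℝ} (hT : ∀ j ∉ T, x j = 0) :
    |realDeviation B x| ≤ n * t * ∑ j, x j ^ 2 := by
  have hN1 : (1 : ℝ) ≤ N := by exact_mod_cast hN
  have key : ∀ x : Fin N → ℝ, (∀ j ∉ T, x j = 0) → ∑ j, x j ^ 2 ≤ 1 →
      |realDeviation B x| ≤ n * t := by
    intro x hT hx
    obtain ⟨z, hz, hnear⟩ := exists_gridVectors_near (L := 8 * N ^ 3) (by positivity) hT hx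
    have hxj : ∀ j, |x j| ≤ 1 := fun j => by
      rw [← sq_le_one_iff_abs_le_one]
      exact (Finset.single_le_sum (fun i _ => sq_nonneg (x i)) (Finset.mem_univ j)).trans hx
    have h1 := abs_realDeviation_sub_le hB hxj (fun j => (hnear j).1) fun j => (hnear j).2
    have h2 := h z hz
    -- The mesh 1/(8N³) makes the rounding error at most 1/(2N) ≤ t/2; the other t/2 comes from the
    -- grid point.
    have h3 : 2 * ((N : ℝ) ^ 2 + N) * (1 / (8 * N ^ 3 : ℕ)) ≤ t / 2 := by
      push_cast
      rw [mul_one_div, div_le_iff₀ (by positivity)]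
      rw [div_le_iff₀ (by positivity)] at ht
      have : (N : ℝ) ≤ N ^ 2 := by nlinarith
      calc 2 * ((N : ℝ) ^ 2 + N) ≤ 2 * (N ^ 2 + N ^ 2) := by gcongr
        _ = 4 * (N : ℝ) ^ 2 * 1 := by ring
        _ ≤ 4 * (N : ℝ) ^ 2 * (t * N) := by gcongr
        _ = _ := by ring
    have h4 : (n : ℝ) * (2 * ((N : ℝ) ^ 2 + N) * (1 / (8 * N ^ 3 : ℕ))) ≤ n * (t / 2) := by gcongr
    have h5 := abs_sub_abs_le_abs_sub (realDeviation B x)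
      (realDeviation B fun j => (z j : ℝ) / (8 * N ^ 3 : ℕ))
    linarith
  rcases eq_or_ne (∑ j, x j ^ 2) 0 with h0 | h0
  · have hx0 : x = 0 := by
      ext j
      have := (Finset.sum_eq_zero_iff_of_nonneg fun i _ => sq_nonneg (x i)).1 h0 j
        (Finset.mem_univ j)
      simpa using this
    subst hx0
    simp [realDeviation]
  · have hpos : 0 < ∑ j, x j ^ 2 :=
      lt_of_le_of_ne (Finset.sum_nonneg fun i _ => sq_nonneg (x i)) h0.symm
    set c := (√(∑ j, x j ^ 2))⁻¹ with hc
    have hc2 : c ^ 2 = (∑ j, x j ^ 2)⁻¹ := by rw [hc, inv_pow, Real.sq_sqrt hpos.le]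
    have := key (c • x) (fun j hj => by simp [hT j hj]) (by
      simp only [Pi.smul_apply, smul_eq_mul, mul_pow, ← Finset.mul_sum, hc2]
      rw [inv_mul_cancel₀ h0])
    rwa [realDeviation_smul, hc2, abs_mul, abs_of_pos (by positivity), inv_mul_eq_div,
      div_le_iff₀ hpos] at this

/-! ### From real to complex vectors -/

theorem normalized_mulVec {n N : ℕ} (B : Matrix (Fin n) (Fin N) ℝ) (x : Fin N → ℂ) (l : Fin n) :
    ‖(normalized B *ᵥ x) l‖ ^ 2 =
      ((B *ᵥ fun j => (x j).re) l ^ 2 + (B *ᵥ fun j => (x j).im) l ^ 2) / n := by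
  have hre : ((normalized B *ᵥ x) l).re = (B *ᵥ fun j => (x j).re) l / √n := by
    simp only [Matrix.mulVec, dotProduct, normalized, Matrix.map_apply, Complex.re_sum,
      Complex.re_ofReal_mul, Finset.sum_div]
    exact Finset.sum_congr rfl fun j _ => by ring
  have him : ((normalized B *ᵥ x) l).im = (B *ᵥ fun j => (x j).im) l / √n := by
    simp only [Matrix.mulVec, dotProduct, normalized, Matrix.map_apply, Complex.im_sum,
      Complex.im_ofReal_mul, Finset.sum_div]
    exact Finset.sum_congr rfl fun j _ => by ring
  rw [← Complex.normSq_eq_norm_sq, Complex.normSq_apply, hre, him, add_div, ← sq, ← sq, div_pow,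
    div_pow, Real.sq_sqrt (Nat.cast_nonneg n)]

theorem sqNorm_eq_re_add_im {N : ℕ} (x : Fin N → ℂ) :
    sqNorm x = ∑ j, (x j).re ^ 2 + ∑ j, (x j).im ^ 2 := by
  rw [sqNorm_eq_sum, ← Finset.sum_add_distrib]
  refine Finset.sum_congr rfl fun j _ => ?_
  rw [← Complex.normSq_eq_norm_sq, Complex.normSq_apply]
  ring

/-- A real matrix acts separately on real and imaginary parts, so a grid of real vectors controls
complex ones with the same constant. -/
theorem deviation_normalized {n N : ℕ} (hn : 0 < n) (B : Matrix (Fin n) (Fin N) ℝ)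
    (x : Fin N → ℂ) :
    n * deviation (normalized B) x =
      realDeviation B (fun j => (x j).re) + realDeviation B fun j => (x j).im := by
  have hn' : (n : ℝ) ≠ 0 := by positivity
  rw [deviation, sqNorm_eq_re_add_im x, sqNorm_eq_sum]
  simp only [normalized_mulVec, realDeviation, Finset.sum_sub_distrib, ← Finset.sum_div,
    Finset.sum_add_distrib, Finset.sum_const, Finset.card_univ, Fintype.card_fin, nsmul_eq_mul]
  field_simp
  ring

theorem hasUnitColumns_normalized {n N : ℕ} (hn : 0 < n) {B : Matrix (Fin n) (Fin N) ℝ}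
    (hB : ∀ i j, |B i j| = 1) : HasUnitColumns (normalized B) := by
  have hn' : (n : ℝ) ≠ 0 := by positivity
  intro j
  rw [sqNorm_eq_sum]
  have : ∀ i, ‖normalized B i j‖ ^ 2 = 1 / n := by
    intro i
    rw [normalized, Matrix.map_apply, Complex.norm_real, Real.norm_eq_abs, abs_div, hB,
      abs_of_nonneg (Real.sqrt_nonneg _), div_pow, Real.sq_sqrt (Nat.cast_nonneg n), one_pow]
  simp [this, hn']

theorem abs_deviation_normalized_le {n N m : ℕ} (hn : 0 < n) (hN : 0 < N) (hm : m ≤ N)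
    {B : Matrix (Fin n) (Fin N) ℝ} (hB : ∀ i j, |B i j| = 1) {t : ℝ} (ht : 1 / N ≤ t)
    (h : ∀ T ∈ (Finset.univ : Finset (Fin N)).powersetCard m, ∀ z ∈ gridVectors (8 * N ^ 3) T,
      |realDeviation B fun j => (z j : ℝ) / (8 * N ^ 3 : ℕ)| ≤ n * (t / 2))
    {x : Fin N → ℂ} (hx : IsSparse m x) : |deviation (normalized B) x| ≤ t * sqNorm x := by
  obtain ⟨T, hc, hT⟩ := hx.exists_finset hm
  have hg := h T (Finset.mem_powersetCard.2 ⟨Finset.subset_univ _, hc⟩)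
  have h1 := abs_realDeviation_le_of_grid (fun i j => (hB i j).le) hN ht hg
    (x := fun j => (x j).re) fun j hj => by simp [hT j hj]
  have h2 := abs_realDeviation_le_of_grid (fun i j => (hB i j).le) hN ht hg
    (x := fun j => (x j).im) fun j hj => by simp [hT j hj]
  have hn' : (0 : ℝ) < n := by exact_mod_cast hn
  refine le_of_mul_le_mul_left ?_ hn'
  rw [← abs_of_pos hn', ← abs_mul, abs_of_pos hn', deviation_normalized hn, sqNorm_eq_re_add_im]
  refine (abs_add_le _ _).trans ?_
  linarith

/-! ### Certification and the union bound -/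

theorem two_le_lazyOrder {N : ℕ} (hN : 3 ≤ N) : 2 ≤ lazyOrder N :=
  Nat.lt_ceil.2 (by exact_mod_cast one_lt_pow₀ (one_lt_log_of_three_le hN) (by norm_num))

/-- If the restricted isometry constant of order `m` is at most `(m - 1) / R`, then all orders up
to `δ R` are certified. -/
theorem certified_of_abs_deviation_le {n N m : ℕ} {Φ : Matrix (Fin n) (Fin N) ℂ} {δ R : ℝ}
    (hm : 2 ≤ m) (hΦ : HasUnitColumns Φ) (hδ : 0 < δ) (hR : 0 < R) (hRN : δ * R ≤ N)
    (hmR : m ≤ δ * R)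
    (h : ∀ x, IsSparse m x → |deviation Φ x| ≤ ((m : ℝ) - 1) / R * sqNorm x) (k : ℕ)
    (hk : k ≤ δ * R) :
    SatisfiesRIP Φ k δ ∧ (m ≤ k → k ∈ (lazyAlgorithm Φ m δ).val) := by
  have hm2 : (2 : ℝ) ≤ m := by exact_mod_cast hm
  have hm1 : 0 < (m : ℝ) - 1 := by linarith
  have hrip : ripParam Φ m ≤ ((m : ℝ) - 1) / R := (ripParam_le_iff Φ m (by positivity)).2 h
  have key : ∀ k : ℕ, m ≤ k → k ≤ δ * R →
      ripParam Φ m * ((k : ℝ) - 1) / ((m : ℝ) - 1) ≤ δ := by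
    intro k hmk hk
    have hk1 : (2 : ℝ) ≤ k := by exact_mod_cast hm.trans hmk
    calc ripParam Φ m * ((k : ℝ) - 1) / ((m : ℝ) - 1)
        ≤ ((m : ℝ) - 1) / R * ((k : ℝ) - 1) / ((m : ℝ) - 1) := by
          gcongr
          linarith
      _ = ((k : ℝ) - 1) / R := by field_simp
      _ ≤ δ := by rw [div_le_iff₀ hR]; linarith
  have hrip' : ∀ k : ℕ, m ≤ k → k ≤ δ * R → SatisfiesRIP Φ k δ := fun k hmk hk =>
    satisfiesRIP_of_ripParam_le hm hΦ hmk (key k hmk hk)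
  refine ⟨?_, fun hmk => ?_⟩
  · rcases le_total m k with hmk | hmk
    · exact hrip' k hmk hk
    · exact fun x hx => hrip' m le_rfl hmR x (hx.mono hmk)
  · rw [mem_lazyAlgorithm_iff Φ hm hδ.le]
    exact ⟨hmk, by exact_mod_cast hk.trans hRN, key k hmk hk⟩

section Random

variable {Ω : Type*} [MeasurableSpace Ω] {μ : Measure Ω} {n N : ℕ}
  {A : Ω → Matrix (Fin n) (Fin N) ℝ}

/-- The grid vectors at which a random matrix deviates much are improbable. -/
theorem IsBernoulliMatrix.measureReal_exists_grid_le [IsProbabilityMeasure μ]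
    (h : IsBernoulliMatrix μ A) (hN : 3 ≤ N) (m : ℕ) {τ : ℝ} (hτ : 0 ≤ τ) (hτ1 : τ ≤ 1) :
    μ.real {ω | ∃ T ∈ (Finset.univ : Finset (Fin N)).powersetCard m,
      ∃ z ∈ gridVectors (8 * N ^ 3) T,
        n * τ ≤ |realDeviation (A ω) fun j => (z j : ℝ) / (8 * N ^ 3 : ℕ)|} ≤
      (N : ℝ) ^ (7 * m) * (2 * Real.exp (-(n * τ ^ 2 / 1024))) := by
  set b := 2 * Real.exp (-(n * τ ^ 2 / 1024)) with hb
  set E : (Fin N → ℤ) → Set Ω := fun z =>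
    {ω | n * τ ≤ |realDeviation (A ω) fun j => (z j : ℝ) / (8 * N ^ 3 : ℕ)|} with hE
  have hset : {ω | ∃ T ∈ (Finset.univ : Finset (Fin N)).powersetCard m,
      ∃ z ∈ gridVectors (8 * N ^ 3) T,
        n * τ ≤ |realDeviation (A ω) fun j => (z j : ℝ) / (8 * N ^ 3 : ℕ)|} =
      ⋃ T ∈ (Finset.univ : Finset (Fin N)).powersetCard m,
        ⋃ z ∈ gridVectors (8 * N ^ 3) T, E z := by
    ext ω
    simp [hE]
  rw [hset]
  have h1 : ∀ T ∈ (Finset.univ : Finset (Fin N)).powersetCard m,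
      μ.real (⋃ z ∈ gridVectors (8 * N ^ 3) T, E z) ≤ (2 * (8 * N ^ 3) + 1 : ℕ) ^ m * b := by
    intro T hT
    refine (measureReal_biUnion_finset_le _ _).trans ?_
    calc ∑ z ∈ gridVectors (8 * N ^ 3) T, μ.real (E z)
        ≤ ∑ _z ∈ gridVectors (8 * N ^ 3) T, b := by
          refine Finset.sum_le_sum fun z hz => ?_
          exact h.measureReal_abs_sum_ge_le (Finset.mem_filter.1 hz).2 hτ hτ1
      _ = (gridVectors (8 * N ^ 3) T).card * b := by simp
      _ ≤ _ := by
          gcongr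
          rw [← (Finset.mem_powersetCard.1 hT).2]
          exact_mod_cast card_gridVectors_le (8 * N ^ 3) T
  refine (measureReal_biUnion_finset_le _ _).trans ((Finset.sum_le_sum h1).trans ?_)
  rw [Finset.sum_const, Finset.card_powersetCard, Finset.card_univ, Fintype.card_fin, nsmul_eq_mul,
    ← mul_assoc]
  gcongr
  -- Exponent 7 = 1 + 6: at most N^m supports, with at most N^(6m) grid points on each.
  have h2 : 2 * (8 * N ^ 3) + 1 ≤ N ^ 6 := by
    have : 27 ≤ N ^ 3 := Nat.pow_le_pow_left hN 3
    rw [show N ^ 6 = N ^ 3 * N ^ 3 by ring]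
    nlinarith
  have h3 : N.choose m * (2 * (8 * N ^ 3) + 1) ^ m ≤ N ^ (7 * m) := by
    calc N.choose m * (2 * (8 * N ^ 3) + 1) ^ m ≤ N ^ m * (N ^ 6) ^ m := by
          gcongr
          exact Nat.choose_le_pow N m
      _ = N ^ (7 * m) := by rw [← pow_mul, ← pow_add]; congr 1; ring
  exact_mod_cast h3

/-- Gives R ≤ N: certifiable orders do not exceed N, and the target (m − 1)/R is at least 1/N, as
the grid requires. -/
theorem log_mul_sqrt_le {n N : ℕ} (hN : 0 < N) (hn : n ≤ N) :
    1 / 512 * Real.log N * √(n : ℝ) ≤ N := by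
  have hN' : (0 : ℝ) < N := by exact_mod_cast hN
  have h1 : √(n : ℝ) ≤ √(N : ℝ) := Real.sqrt_le_sqrt (by exact_mod_cast hn)
  have h2 : Real.log N ≤ 2 * √(N : ℝ) := by
    have := Real.log_le_sub_one_of_pos (Real.sqrt_pos.2 hN')
    rw [Real.log_sqrt hN'.le] at this
    linarith
  have h3 := Real.mul_self_sqrt hN'.le
  calc 1 / 512 * Real.log N * √(n : ℝ) ≤ 1 / 512 * (2 * √(N : ℝ)) * √(N : ℝ) := by gcongr
    _ = 1 / 256 * (√(N : ℝ) * √(N : ℝ)) := by ring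
    _ ≤ N := by rw [h3]; linarith

/-- The constant 1/512 makes the tail exponent 64(m − 1)²/Λ² ≥ 16m²/Λ² ≥ 16mΛ, by m ≥ 2 and m ≥ Λ³.
The union bound costs only 7mΛ, and mΛ ≥ Λ⁴. -/
theorem pow_mul_exp_le {N m : ℕ} {n : ℝ} (hN : 3 ≤ N) (hm : m = lazyOrder N) (hn : 0 < n) :
    (N : ℝ) ^ (7 * m) * (2 * Real.exp (-(n *
      (((m : ℝ) - 1) / (1 / 512 * Real.log N * √n) / 2) ^ 2 / 1024))) ≤
      2 ^ (-(1 * Real.log N ^ 4)) := by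
  set Λ := Real.log N with hΛ
  have hΛ1 : 1 < Λ := one_lt_log_of_three_le hN
  have hm2 : (2 : ℝ) ≤ m := by exact_mod_cast hm ▸ two_le_lazyOrder hN
  have hmΛ : Λ ^ 3 ≤ m := by rw [hm]; exact Nat.le_ceil _
  have hNpos : (0 : ℝ) < N := by positivity
  have e1 : n * (((m : ℝ) - 1) / (1 / 512 * Λ * √n) / 2) ^ 2 / 1024 =
      64 * ((m : ℝ) - 1) ^ 2 / Λ ^ 2 := by
    rw [div_pow, div_pow, mul_pow, Real.sq_sqrt hn.le]
    field_simp
    ring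
  have e2 : (N : ℝ) ^ (7 * m) = Real.exp (7 * (m * Λ)) := by
    rw [← Real.rpow_natCast, Real.rpow_def_of_pos hNpos]
    congr 1
    push_cast
    ring
  have h1 : 16 * (m * Λ) ≤ 64 * ((m : ℝ) - 1) ^ 2 / Λ ^ 2 := by
    rw [le_div_iff₀ (by positivity)]
    have : (m : ℝ) / 2 ≤ m - 1 := by linarith
    calc 16 * (m * Λ) * Λ ^ 2 = 16 * (m : ℝ) * Λ ^ 3 := by ring
      _ ≤ 16 * (m : ℝ) * m := by gcongr
      _ = 64 * ((m : ℝ) / 2) ^ 2 := by ring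
      _ ≤ _ := by gcongr
  have h2 : Λ ^ 4 ≤ m * Λ := by
    calc Λ ^ 4 = Λ ^ 3 * Λ := by ring
      _ ≤ _ := by gcongr
  have h3 : 1 ≤ m * Λ := by nlinarith
  rw [e1, e2]
  calc Real.exp (7 * (m * Λ)) * (2 * Real.exp (-(64 * ((m : ℝ) - 1) ^ 2 / Λ ^ 2)))
      ≤ Real.exp (7 * (m * Λ)) * (Real.exp 1 * Real.exp (-(16 * (m * Λ)))) := by
        gcongr
        linarith [Real.exp_one_gt_d9]
    _ = Real.exp (1 - 9 * (m * Λ)) := by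
        rw [← Real.exp_add, ← Real.exp_add]
        congr 1
        ring
    _ ≤ Real.exp (Real.log 2 * -(1 * Λ ^ 4)) := by
        rw [Real.exp_le_exp]
        have : Real.log 2 * Λ ^ 4 ≤ 1 * Λ ^ 4 := by
          gcongr
          linarith [Real.log_two_lt_d9]
        linarith
    _ = _ := (Real.rpow_def_of_pos two_pos _).symm

theorem IsBernoulliMatrix.le_measure_certified [IsProbabilityMeasure μ]
    (h : IsBernoulliMatrix μ A) {δ : ℝ} (hN : 3 ≤ N) (hnN : n ≤ N) (hδ : 0 < δ) (hδ1 : δ < 1)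
    (hm : (lazyOrder N : ℝ) ≤ 1 / 512 * δ * Real.log N * √(n : ℝ)) :
    1 - ENNReal.ofReal (2 ^ (-(1 * Real.log N ^ 4))) ≤
      μ {ω | ∀ k : ℕ, (k : ℝ) ≤ 1 / 512 * δ * Real.log N * √(n : ℝ) →
        SatisfiesRIP (normalized (A ω)) k δ ∧
        (lazyOrder N ≤ k → k ∈ (lazyAlgorithm (normalized (A ω)) (lazyOrder N) δ).val)} := by
  set m := lazyOrder N with hmdef
  set R := 1 / 512 * Real.log N * √(n : ℝ) with hR
  have hδR : 1 / 512 * δ * Real.log N * √(n : ℝ) = δ * R := by rw [hR]; ring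
  rw [hδR] at hm ⊢
  have hm2 : 2 ≤ m := two_le_lazyOrder hN
  have hm2' : (2 : ℝ) ≤ m := by exact_mod_cast hm2
  have hRN : R ≤ N := log_mul_sqrt_le (by omega) hnN
  have hR0 : 0 < R := pos_of_mul_pos_right (by linarith : 0 < δ * R) hδ.le
  have hδRR : δ * R ≤ R := by nlinarith
  have hn : 0 < n := by
    rcases Nat.eq_zero_or_pos n with h0 | h0
    · rw [hR, h0] at hR0
      simp at hR0
    · exact h0
  have hn' : (0 : ℝ) < n := by exact_mod_cast hn
  have hNpos : (0 : ℝ) < N := by positivity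
  have hmN : m ≤ N := by exact_mod_cast hm.trans (hδRR.trans hRN)
  set t := ((m : ℝ) - 1) / R with ht
  have ht0 : 1 / N ≤ t := by
    rw [ht]
    exact div_le_div₀ (by linarith) (by linarith) hR0 hRN
  -- m ≤ δR ≤ R keeps t/2 in the range of the concentration bound.
  have ht1 : t ≤ 1 := by rw [ht, div_le_one hR0]; linarith
  have htnonneg : 0 ≤ t := le_trans (by positivity) ht0
  set G := {ω | ∀ k : ℕ, (k : ℝ) ≤ δ * R → SatisfiesRIP (normalized (A ω)) k δ ∧
        (m ≤ k → k ∈ (lazyAlgorithm (normalized (A ω)) m δ).val)} with hG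
  set E := {ω | ∃ T ∈ (Finset.univ : Finset (Fin N)).powersetCard m,
      ∃ z ∈ gridVectors (8 * N ^ 3) T,
        n * (t / 2) ≤ |realDeviation (A ω) fun j => (z j : ℝ) / (8 * N ^ 3 : ℕ)|} with hE
  have hbound : μ.real E ≤ 2 ^ (-(1 * Real.log N ^ 4)) :=
    (h.measureReal_exists_grid_le hN m (by positivity) (by linarith)).trans
      (pow_mul_exp_le hN hmdef hn')
  have hsub : ∀ᵐ ω ∂μ, ω ∉ G → ω ∈ E := by
    filter_upwards [h.ae_eq_one_or] with ω hω hωG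
    by_contra hωE
    refine hωG fun k hk => ?_
    have hB : ∀ i j, |A ω i j| = 1 := fun i j => by
      rcases hω i j with h1 | h1 <;> rw [h1] <;> simp
    refine certified_of_abs_deviation_le hm2 (hasUnitColumns_normalized hn hB) hδ hR0
      (hδRR.trans hRN) hm (fun x hx => ?_) k hk
    refine abs_deviation_normalized_le hn (by omega) hmN hB ht0 (fun T hT z hz => ?_) hx
    by_contra hlt
    exact hωE ⟨T, hT, z, hz, (not_le.1 hlt).le⟩
  have hcompl : μ Gᶜ ≤ ENNReal.ofReal (2 ^ (-(1 * Real.log N ^ 4))) := by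
    have h1 : μ Gᶜ ≤ μ E := measure_mono_ae hsub
    refine h1.trans ?_
    rw [← ofReal_measureReal]
    exact ENNReal.ofReal_le_ofReal hbound
  -- Subadditivity over G and its complement suffices, so G need not be measurable.
  rw [tsub_le_iff_right]
  calc (1 : ℝ≥0∞) = μ (G ∪ Gᶜ) := by rw [Set.union_compl_self, measure_univ]
    _ ≤ μ G + μ Gᶜ := measure_union_le _ _
    _ ≤ _ := by gcongr

end Random

end

theorem mainTheorem10 :
    -- the algorithm is correct on every input
    (∀ (n N m : ℕ) (Φ : Matrix (Fin n) (Fin N) ℂ) (δ : ℝ),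
      2 ≤ m → m ≤ n → n ≤ N → HasUnitColumns Φ → 0 < δ → δ < 1 → ∀ k : ℕ,
        (k ∈ (lazyAlgorithm Φ m δ).val ↔
          m ≤ k ∧ k ≤ N ∧ ripParam Φ m * ((k : ℝ) - 1) / ((m : ℝ) - 1) ≤ δ) ∧
        (k ∈ (lazyAlgorithm Φ m δ).val → SatisfiesRIP Φ k δ)) ∧
    -- running time
    (∃ C : ℝ, 0 < C ∧ ∀ (n N : ℕ) (Φ : Matrix (Fin n) (Fin N) ℂ) (δ : ℝ),
      3 ≤ N → n ≤ N → 0 < δ → δ < 1 →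
        ((lazyAlgorithm Φ (lazyOrder N) δ).steps : ℝ) ≤ 2 ^ (C * Real.log N ^ 4)) ∧
    -- certification of random matrices
    (∃ K c : ℝ, 0 < K ∧ 0 < c ∧ ∀ (n N : ℕ) (δ : ℝ),
      3 ≤ N → n ≤ N → 0 < δ → δ < 1 →
      (lazyOrder N : ℝ) ≤ K * δ * Real.log N * √(n : ℝ) →
      ∀ (Ω : Type*) [MeasurableSpace Ω] (μ : Measure Ω) [IsProbabilityMeasure μ]
        (A : Ω → Matrix (Fin n) (Fin N) ℝ), IsBernoulliMatrix μ A →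
        1 - ENNReal.ofReal (2 ^ (-(c * Real.log N ^ 4))) ≤
          μ {ω | ∀ k : ℕ, (k : ℝ) ≤ K * δ * Real.log N * √(n : ℝ) →
            SatisfiesRIP (normalized (A ω)) k δ ∧
            (lazyOrder N ≤ k →
              k ∈ (lazyAlgorithm (normalized (A ω)) (lazyOrder N) δ).val)}) := by
  refine ⟨fun n N m Φ δ hm _ _ hΦ hδ _ k => ?_, ⟨16 / Real.log 2, by
    have := Real.log_pos one_lt_two
    positivity, fun n N Φ δ hN hn _ _ => steps_lazyAlgorithm_lazyOrder_le Φ δ hN hn⟩,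
    1 / 512, 1, by norm_num, one_pos, fun n N δ hN hn hδ hδ1 hm Ω _ μ _ A hA =>
      hA.le_measure_certified hN hn hδ hδ1 hm⟩
  have h := mem_lazyAlgorithm_iff Φ hm hδ.le k
  exact ⟨h, fun hk => satisfiesRIP_of_ripParam_le hm hΦ (h.1 hk).1 (h.1 hk).2.2⟩
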